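/- **Theorem 4.7 (ADMM / Douglas–Rachford with infimal postcompositions).** Let $\mathcal X,\mathcal Y,\mathcal U$ be real Hilbert spaces, let $f:\mathcal X\to\mathbb R\cup\{+\infty\}$ and $g:\mathcal Y\to\mathbb R\cup\{+\infty\}$ be convex, proper and lower semicontinuous, let $L:\mathcal X\to\mathcal U$ and $K:\mathcal Y\to\mathcal U$ be nonzero bounded linear operators, and let $c\in\mathcal U$. Consider the primal problem $$\text{(P)}\qquad \min_{(x,y)\in\mathcal X\times\mathcal Y} f(x)+g(y)\quad\text{s.t.}\quad Lx+Ky=c,$$ the dual problem $$\text{(D)}\qquad \min_{u\in\mathcal U} f^*(-L^*u)+g^*(-K^*u)+\langle u,c\rangle,$$ where $f^*,g^*$ are the Fenchel conjugates and $L^*,K^*$ the adjoints, and the reformulated problem $$\text{(R)}\qquad \min_{r\in\mathcal U}\ (L\triangleright f)(r)+((-K)\triangleright g)(r-c),$$ where $(L\triangleright f)(r)=\inf\{f(x): x\in\mathcal X,\ Lx=r\}$ and $((-K)\triangleright g)(r)=\inf\{g(y): y\in\mathcal Y,\ -Ky=r\}$ (with $\inf\emptyset=+\infty$). Assume that 1.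 there is $(x,y,u)\in\mathcal X\times\mathcal Y\times\mathcal U$ with $0\in\partial f(x)+L^*u$, $0\in\partial g(y)+K^*u$ and $Lx+Ky=c$; 2. both infimal postcompositions are exact: for every $r\in\operatorname{ran}L$, $f$ attains its minimum over $\{x: Lx=r\}$, and for every $r\in\operatorname{ran}K$, $g$ attains its minimum over $\{y: -Ky=r\}$; 3. $L\triangleright f$ and $(-K)\triangleright g$ are lower semicontinuous. Let $\tau>0$, let $(\rho^{(i)})_{i\in\mathbb N}$ be a sequence in $[0,2]$ with $\sum_{i\in\mathbb N}\rho^{(i)}(2-\rho^{(i)})=+\infty$, and let $y^{(0)}\in\mathcal Y$, $\tilde v^{(0)},s^{(0)}\in\mathcal U$ satisfy $s^{(0)}=-Ky^{(0)}+c-\tilde v^{(0)}$. Consider the ADMM iteration, for $i=0,1,\ldots$, $$\begin{aligned} x^{(i+\frac12)}&\in\operatorname*{argmin}_{x\in\mathcal X}\ \tau f(x)+\tfrac12\|Lx+Ky^{(i)}-c+\tilde v^{(i)}\|^2,\\ \tilde v^{(i+\frac12)}&=\tilde v^{(i)}+Lx^{(i+\frac12)}+Ky^{(i)}-c,\\ y^{(i+1)}&\in\operatorname*{argmin}_{y\in\mathcal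 Y}\ \tau g(y)+\tfrac12\|Lx^{(i+\frac12)}+Ky-c+\tilde v^{(i+\frac12)}\|^2,\\ \tilde v^{(i+1)}&=\tilde v^{(i+\frac12)}+(\rho^{(i)}-1)\big(Lx^{(i+\frac12)}+Ky^{(i+1)}-c\big), \end{aligned}$$ and the Douglas–Rachford iteration, for $i=0,1,\ldots$, $$\begin{aligned} x^{(i+\frac12)}&\in\operatorname*{argmin}_{x\in\mathcal X}\ \tau f(x)+\tfrac12\|Lx-s^{(i)}\|^2,\\ y^{(i+1)}&\in\operatorname*{argmin}_{y\in\mathcal Y}\ \tau g(y)+\tfrac12\|Ky-c+2Lx^{(i+\frac12)}-s^{(i)}\|^2,\\ s^{(i+1)}&=s^{(i)}-\rho^{(i)}\big(Lx^{(i+\frac12)}+Ky^{(i+1)}-c\big). \end{aligned}$$ For every $r\in\mathcal U$ the functions $\tau f+\frac12\|L\cdot-r\|^2$ and $\tau g+\frac12\|K\cdot+r\|^2$ have minimizers, so both iterations can be carried out, and they are equivalent: they generate the same pairs of sequences $(x^{(i+\frac12)})_{i\in\mathbb N}$, $(y^{(i)})_{i\in\mathbb N}$. Moreover, for all sequences generated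 by either iteration (and whatever the choice of minimizers): * $(Lx^{(i+\frac12)})_{i\in\mathbb N}$ and $(-Ky^{(i)}+c)_{i\in\mathbb N}$ both converge weakly to the same element $r^\star\in\mathcal U$, which is a solution of (R); * for the ADMM, $(\tilde v^{(i+\frac12)}/\tau)_{i\in\mathbb N}$ and $(\tilde v^{(i)}/\tau)_{i\in\mathbb N}$ both converge weakly to the same element $u^\star\in\mathcal U$, which is a solution of (D); * $Lx^{(i+\frac12)}+Ky^{(i+1)}-c\to0$ strongly. Furthermore, if $\mathcal X,\mathcal Y,\mathcal U$ are finite-dimensional and, for every $r\in\mathcal U$, the minimizers of $\tau f+\frac12\|L\cdot-r\|^2$ and of $\tau g+\frac12\|K\cdot+r\|^2$ are unique, then the sequence $(x^{(i+\frac12)},y^{(i)})_{i\in\mathbb N}$ generated by either iteration converges to a solution of (P). -/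

import Mathlib

open Filter Topology
open scoped InnerProductSpace

/- Extended-real-valued functions are modelled with `EReal`; values in `ℝ ∪ {+∞}` are expressed
by the requirement `f x ≠ ⊥`. -/

/-- The class `Γ₀(H)` of convex, proper, lower semicontinuous functions from a real Hilbert
space to `ℝ ∪ {+∞}`. (In `EReal` one has `0 * ⊤ = 0`, so the convexity inequality is the usual
one also when one of the weights vanishes.) -/
structure IsGammaZero {H : Type*} [NormedAddCommGroup H] [InnerProductSpace ℝ H]
    (f : H → EReal) : Prop where
  ne_bot : ∀ x, f x ≠ ⊥
  proper : ∃ x, f x ≠ ⊤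
  convex : ∀ (x y : H) (a b : ℝ), 0 ≤ a → 0 ≤ b → a + b = 1 →
    f (a • x + b • y) ≤ (a : EReal) * f x + (b : EReal) * f y
  lsc : LowerSemicontinuous f

/-- The set of global minimizers of an extended-real-valued function. -/
def argminSet {E : Type*} (F : E → EReal) : Set E :=
  {x | ∀ x', F x ≤ F x'}

/-- The subdifferential `∂f(x) = {u : ∀ y, f x + ⟪y - x, u⟫ ≤ f y}`. -/
def subdiff {H : Type*} [NormedAddCommGroup H] [InnerProductSpace ℝ H]
    (f : H → EReal) (x : H) : Set H :=
  {u | ∀ y, f x + ((⟪y - x, u⟫_ℝ : ℝ) : EReal) ≤ f y}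

/-- The Fenchel conjugate `f*(u) = sup_x (⟪u, x⟫ - f x)`. -/
noncomputable def fenchelConj {H : Type*} [NormedAddCommGroup H] [InnerProductSpace ℝ H]
    (f : H → EReal) (u : H) : EReal :=
  ⨆ x : H, ((⟪u, x⟫_ℝ : ℝ) : EReal) - f x

/-- The infimal postcomposition `(L ▷ f)(r) = inf {f x : L x = r}`, equal to `+∞` when `r` is
not in the range of `L`. -/
noncomputable def infPostcomp {X U : Type*} (L : X → U) (f : X → EReal) (r : U) : EReal :=
  ⨅ (x : X) (_ : L x = r), f x

/-- The infimal postcomposition is exact: for every `r` in the range of `L`, the infimum over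
`L⁻¹{r}` is attained. -/
def IsExactPostcomp {X U : Type*} (L : X → U) (f : X → EReal) : Prop :=
  ∀ r ∈ Set.range L, ∃ x, L x = r ∧ ∀ x', L x' = r → f x ≤ f x'

/-- Weak convergence of a sequence: convergence in the weak topology. -/
def WeaklyTendsto {H : Type*} [NormedAddCommGroup H] [InnerProductSpace ℝ H]
    (z : ℕ → H) (a : H) : Prop :=
  Tendsto (fun n => toWeakSpace ℝ H (z n)) atTop (𝓝 (toWeakSpace ℝ H a))

section Problem

variable {X Y U : Type*}
  [NormedAddCommGroup X] [InnerProductSpace ℝ X] [CompleteSpace X]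
  [NormedAddCommGroup Y] [InnerProductSpace ℝ Y] [CompleteSpace Y]
  [NormedAddCommGroup U] [InnerProductSpace ℝ U] [CompleteSpace U]

/-- `(x, y)` solves: minimize `f x + g y` subject to `L x + K y = c`. -/
def IsPrimalSol (f : X → EReal) (g : Y → EReal) (L : X →L[ℝ] U) (K : Y →L[ℝ] U) (c : U)
    (x : X) (y : Y) : Prop :=
  L x + K y = c ∧ ∀ x' y', L x' + K y' = c → f x + g y ≤ f x' + g y'

/-- `u` solves: minimize `f*(-L* u) + g*(-K* u) + ⟪u, c⟫`. -/
def IsDualSol (f : X → EReal) (g : Y → EReal) (L : X →L[ℝ] U) (K : Y →L[ℝ] U) (c : U)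
    (u : U) : Prop :=
  u ∈ argminSet fun u : U =>
    fenchelConj f (-(L.adjoint u)) + fenchelConj g (-(K.adjoint u)) + ((⟪u, c⟫_ℝ : ℝ) : EReal)

/-- `(x, y, u)` solves the primal-dual inclusion
`0 ∈ ∂f(x) + L* u`, `0 ∈ ∂g(y) + K* u`, `0 = -L x - K y + c`. -/
def IsPrimalDualSol (f : X → EReal) (g : Y → EReal) (L : X →L[ℝ] U) (K : Y →L[ℝ] U) (c : U)
    (x : X) (y : Y) (u : U) : Prop :=
  (∃ p ∈ subdiff f x, 0 = p + L.adjoint u) ∧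
  (∃ q ∈ subdiff g y, 0 = q + K.adjoint u) ∧
  0 = -L x - K y + c

/-- `r` solves the reformulated problem: minimize `(L ▷ f)(r) + ((-K) ▷ g)(r - c)`. -/
def IsPostcompSol (f : X → EReal) (g : Y → EReal) (L : X →L[ℝ] U) (K : Y →L[ℝ] U) (c : U)
    (r : U) : Prop :=
  r ∈ argminSet fun r : U => infPostcomp L f r + infPostcomp (-K) g (r - c)

/-- The relaxed ADMM iteration; `xh i` and `vh i` stand for the iterates with index `i + 1/2`,
and `v`, `vh` are the scaled dual variables. -/
structure IsADMM (f : X → EReal) (g : Y → EReal) (L : X →L[ℝ] U) (K : Y →L[ℝ] U) (c : U)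
    (τ : ℝ) (ρ : ℕ → ℝ) (xh : ℕ → X) (y : ℕ → Y) (v vh : ℕ → U) : Prop where
  x_step : ∀ i, xh i ∈ argminSet fun x : X =>
    (τ : EReal) * f x + ((1 / 2 * ‖L x + K (y i) - c + v i‖ ^ 2 : ℝ) : EReal)
  v_half_step : ∀ i, vh i = v i + L (xh i) + K (y i) - c
  y_step : ∀ i, y (i + 1) ∈ argminSet fun y' : Y =>
    (τ : EReal) * g y' + ((1 / 2 * ‖L (xh i) + K y' - c + vh i‖ ^ 2 : ℝ) : EReal)
  v_step : ∀ i, v (i + 1) = vh i + (ρ i - 1) • (L (xh i) + K (y (i + 1)) - c)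

/-- The relaxed Douglas-Rachford iteration; `xh i` stands for the iterate with index
`i + 1/2`. The value `y 0` plays no role in it. -/
structure IsDouglasRachford (f : X → EReal) (g : Y → EReal) (L : X →L[ℝ] U) (K : Y →L[ℝ] U)
    (c : U) (τ : ℝ) (ρ : ℕ → ℝ) (xh : ℕ → X) (y : ℕ → Y) (s : ℕ → U) : Prop where
  x_step : ∀ i, xh i ∈ argminSet fun x : X =>
    (τ : EReal) * f x + ((1 / 2 * ‖L x - s i‖ ^ 2 : ℝ) : EReal)
  y_step : ∀ i, y (i + 1) ∈ argminSet fun y' : Y =>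
    (τ : EReal) * g y' + ((1 / 2 * ‖K y' - c + (2 : ℝ) • L (xh i) - s i‖ ^ 2 : ℝ) : EReal)
  s_step : ∀ i, s (i + 1) = s i - ρ i • (L (xh i) + K (y (i + 1)) - c)

end Problem

/-! `τ f + ½‖L · - s‖²` is minimized by the exact preimages of the proximal point of
`τ (L ▷ f)` at `s`. Both iterations are therefore the Douglas–Rachford algorithm on `U` for
`τ ∂φ` and `τ ∂ψ`, where `φ = L ▷ f` and `ψ = ((-K) ▷ g)(· - c)` belong to `Γ₀(U)`. Its iterates
are Fejér monotone with respect to the fixed points, and the residual `p - q` of the two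
resolvents tends to zero, since its norm decreases and `∑ ρ (2 - ρ) = ∞`. Weak cluster points are
fixed points: although neither factor converges strongly, the inner products in the two
monotonicity inequalities sum to a quantity controlled by the residual. Opial's argument then gives
weak convergence, and a fixed point `r + τ w` with `w ∈ ∂φ(r)`, `-w ∈ ∂ψ(r)` yields the solutions
`r` of (R) and `-w` of (D). In finite dimension a convex lower semicontinuous function with a unique
minimizer is well-posed, so the minimizers themselves converge, by exactness to a solution
of (P). -/

section ERealArithmetic

variable {τ : ℝ}

theorem coe_mul_le_coe_mul_iff (hτ : 0 < τ) {a b : EReal} :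
    (τ : EReal) * a ≤ τ * b ↔ a ≤ b := by
  have hτ' : (0 : EReal) < τ := mod_cast hτ
  refine ⟨fun h => ?_, fun h => mul_le_mul_of_nonneg_left h hτ'.le⟩
  rwa [mul_comm, ← EReal.le_div_iff_mul_le hτ' (EReal.coe_ne_top τ),
    ← EReal.mul_div, mul_comm, EReal.div_mul_cancel (EReal.coe_ne_bot τ) (EReal.coe_ne_top τ)
      hτ'.ne'] at h

theorem coe_mul_add_coe_le_coe_mul_add_coe_iff (hτ : 0 < τ) {a b : EReal} {t : ℝ} :
    (τ : EReal) * a + t ≤ τ * b + t ↔ a ≤ b := by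
  rw [(EReal.addLECancellable_coe t).add_le_add_iff_right, coe_mul_le_coe_mul_iff hτ]

theorem coe_mul_add_coe_le_coe_iff (hτ : 0 < τ) {a : EReal} {t v : ℝ} :
    (τ : EReal) * a + t ≤ v ↔ a ≤ ((v - t) / τ : ℝ) := by
  have : ((τ : EReal) * ((v - t) / τ : ℝ)) + t = v := by
    rw [← EReal.coe_mul, ← EReal.coe_add, mul_div_cancel₀ _ hτ.ne', sub_add_cancel]
  rw [← this, coe_mul_add_coe_le_coe_mul_add_coe_iff hτ]

theorem coe_sub_le_comm {t : ℝ} {a b : EReal} : (t : EReal) - a ≤ b ↔ (t : EReal) - b ≤ a := by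
  induction a with
  | bot => simp [sub_eq_add_neg]
  | top => simp
  | coe a =>
    induction b with
    | bot => simp [← EReal.coe_sub]
    | top => simp
    | coe b => exact_mod_cast sub_le_comm

theorem continuous_coe_mul (hτ : 0 < τ) : Continuous fun a : EReal => (τ : EReal) * a := by
  have hτ' : (τ : EReal) ≠ 0 := mod_cast hτ.ne'
  refine continuous_iff_continuousAt.2 fun a => ?_
  exact (EReal.continuousAt_mul (p := (τ, a)) (.inl hτ') (.inl hτ')
    (.inl (EReal.coe_ne_bot τ)) (.inl (EReal.coe_ne_top τ))).comp (by fun_prop)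

end ERealArithmetic

section GammaZero

variable {H : Type*} [NormedAddCommGroup H] [InnerProductSpace ℝ H] {φ : H → EReal}

namespace IsGammaZero

theorem exists_coe_of_ne_top (hφ : IsGammaZero φ) {x : H} (hx : φ x ≠ ⊤) : ∃ a : ℝ, φ x = a :=
  ⟨(φ x).toReal, (EReal.coe_toReal hx (hφ.ne_bot x)).symm⟩

theorem exists_apply_eq_coe (hφ : IsGammaZero φ) : ∃ (x : H) (a : ℝ), φ x = a :=
  let ⟨x, hx⟩ := hφ.proper
  ⟨x, hφ.exists_coe_of_ne_top hx⟩

theorem combo_le (hφ : IsGammaZero φ) {x y : H} {a b s t : ℝ} (ha : 0 ≤ a) (hb : 0 ≤ b)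
    (hab : a + b = 1) (hx : φ x ≤ s) (hy : φ y ≤ t) :
    φ (a • x + b • y) ≤ (a * s + b * t : ℝ) := by
  refine (hφ.convex x y a b ha hb hab).trans ?_
  rw [EReal.coe_add, EReal.coe_mul, EReal.coe_mul]
  gcongr

theorem of_combo_le (ne_bot : ∀ x, φ x ≠ ⊥) (proper : ∃ x, φ x ≠ ⊤)
    (combo_le : ∀ (x y : H) (a b s t : ℝ), 0 < a → 0 < b → a + b = 1 → φ x ≤ s → φ y ≤ t →
      φ (a • x + b • y) ≤ (a * s + b * t : ℝ))
    (lsc : LowerSemicontinuous φ) : IsGammaZero φ := by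
  have mul_ne_bot : ∀ {a : ℝ} (x : H), 0 < a → (a : EReal) * φ x ≠ ⊥ := by
    intro a x ha
    simp [EReal.mul_eq_bot, ne_bot, ha.not_gt]
  refine ⟨ne_bot, proper, fun x y a b ha hb hab => ?_, lsc⟩
  rcases ha.eq_or_lt with rfl | ha
  · obtain rfl : b = 1 := by linarith
    simp
  rcases hb.eq_or_lt with rfl | hb
  · obtain rfl : a = 1 := by linarith
    simp
  by_cases hx : φ x = ⊤
  · rw [hx, EReal.coe_mul_top_of_pos ha, EReal.top_add_of_ne_bot (mul_ne_bot y hb)]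
    exact le_top
  by_cases hy : φ y = ⊤
  · rw [hy, EReal.coe_mul_top_of_pos hb, EReal.add_top_of_ne_bot (mul_ne_bot x ha)]
    exact le_top
  lift φ x to ℝ using ⟨hx, ne_bot x⟩ with s hs
  lift φ y to ℝ using ⟨hy, ne_bot y⟩ with t ht
  exact_mod_cast combo_le x y a b s t ha hb hab hs.ge ht.ge

theorem quasiconvexOn (hφ : IsGammaZero φ) : QuasiconvexOn ℝ Set.univ φ := by
  intro r x hx y hy a b ha hb hab
  refine ⟨Set.mem_univ _, ?_⟩
  induction r with
  | bot => exact absurd (le_bot_iff.1 hx.2) (hφ.ne_bot x)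
  | top => exact le_top
  | coe r => simpa only [← add_mul, hab, one_mul] using hφ.combo_le ha hb hab hx.2 hy.2

theorem mul_add_coe {τ : ℝ} (hφ : IsGammaZero φ) (hτ : 0 < τ) {N : H → ℝ}
    (hN : ConvexOn ℝ Set.univ N) (hNc : Continuous N) :
    IsGammaZero fun x => (τ : EReal) * φ x + N x := by
  have hlsc : LowerSemicontinuous fun x => (τ : EReal) * φ x :=
    (continuous_coe_mul hτ).comp_lowerSemicontinuous hφ.lsc
      fun _ _ => (coe_mul_le_coe_mul_iff hτ).2
  refine of_combo_le (fun x => ?_) ?_ (fun x y a b s t ha hb hab hx hy => ?_)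
    (hlsc.add' (continuous_coe_real_ereal.comp hNc).lowerSemicontinuous fun x =>
      EReal.continuousAt_add (.inr (EReal.coe_ne_bot _)) (.inr (EReal.coe_ne_top _)))
  · simp [EReal.add_eq_bot_iff, EReal.mul_eq_bot, hφ.ne_bot, hτ.not_gt]
  · obtain ⟨x, a, ha⟩ := hφ.exists_apply_eq_coe
    exact ⟨x, by rw [ha]; exact_mod_cast EReal.coe_ne_top _⟩
  · rw [coe_mul_add_coe_le_coe_iff hτ] at hx hy ⊢
    refine (hφ.combo_le ha.le hb.le hab hx hy).trans (EReal.coe_le_coe_iff.2 ?_)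
    have := hN.2 (Set.mem_univ x) (Set.mem_univ y) ha.le hb.le hab
    rw [le_div_iff₀ hτ]
    field_simp
    simp only [smul_eq_mul] at this
    linarith

theorem comp_sub_const (hφ : IsGammaZero φ) (c : H) : IsGammaZero fun r => φ (r - c) := by
  refine ⟨fun r => hφ.ne_bot _, ?_, fun r r' a b ha hb hab => ?_, ?_⟩
  · obtain ⟨r, hr⟩ := hφ.proper
    exact ⟨r + c, by simpa only [add_sub_cancel_right] using hr⟩
  · have : a • r + b • r' - c = a • (r - c) + b • (r' - c) := by
      rw [smul_sub, smul_sub, sub_add_sub_comm, ← add_smul, hab, one_smul]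
    rw [this]
    exact hφ.convex _ _ a b ha hb hab
  · exact hφ.lsc.comp (continuous_id.sub continuous_const)

end IsGammaZero

end GammaZero

section WeakTopology

variable {ι H : Type*} [NormedAddCommGroup H] [InnerProductSpace ℝ H]

/-- Weak convergence along an arbitrary filter; `WeaklyTendsto` is the case of `atTop`. -/
def TendstoWeakly (z : ι → H) (l : Filter ι) (a : H) : Prop :=
  Tendsto (fun i => toWeakSpace ℝ H (z i)) l (𝓝 (toWeakSpace ℝ H a))

namespace TendstoWeakly

variable {l : Filter ι} {z w : ι → H} {a b : H}

theorem sub (hz : TendstoWeakly z l a) (hw : TendstoWeakly w l b) :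
    TendstoWeakly (fun i => z i - w i) l (a - b) :=
  (Tendsto.sub hz hw :)

theorem const_smul (hz : TendstoWeakly z l a) (t : ℝ) :
    TendstoWeakly (fun i => t • z i) l (t • a) :=
  (Tendsto.const_smul hz t :)

theorem of_tendsto (hz : Tendsto z l (𝓝 a)) : TendstoWeakly z l a :=
  ((toWeakSpaceCLM ℝ H).continuous.tendsto a).comp hz

end TendstoWeakly

theorem lowerSemicontinuous_comp_toWeakSpace_symm {F : H → EReal} (hF : LowerSemicontinuous F)
    (hconv : QuasiconvexOn ℝ Set.univ F) :
    LowerSemicontinuous fun x => F ((toWeakSpace ℝ H).symm x) := by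
  refine lowerSemicontinuous_iff_isClosed_preimage.2 fun v => ?_
  have hclosed : IsClosed {x | F x ≤ v} := lowerSemicontinuous_iff_isClosed_preimage.1 hF v
  have hcv : Convex ℝ {x | F x ≤ v} := by simpa using hconv v
  convert isClosed_closure (s := toWeakSpace ℝ H '' {x | F x ≤ v})
  rw [← hcv.toWeakSpace_closure ℝ, hclosed.closure_eq, LinearEquiv.image_eq_preimage_symm]
  rfl

variable [CompleteSpace H]

theorem tendstoWeakly_iff_inner {l : Filter ι} {z : ι → H} {a : H} :
    TendstoWeakly z l a ↔ ∀ h, Tendsto (fun i => ⟪h, z i⟫_ℝ) l (𝓝 ⟪h, a⟫_ℝ) := by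
  have hinj : Function.Injective ((topDualPairing ℝ H).flip : H → _) := fun x y hxy =>
    ext_inner_left ℝ fun h => congrArg (fun F => F (InnerProductSpace.toDual ℝ H h)) hxy
  refine (WeakBilin.tendsto_iff_forall_eval_tendsto _ hinj).trans
    ⟨fun h v => h (InnerProductSpace.toDual ℝ H v), fun h F => ?_⟩
  have hF := h ((InnerProductSpace.toDual ℝ H).symm F)
  simp only [InnerProductSpace.toDual_symm_apply] at hF
  exact hF

theorem TendstoWeakly.tendsto [FiniteDimensional ℝ H] {l : Filter ι} {z : ι → H} {a : H}
    (hz : TendstoWeakly z l a) : Tendsto z l (𝓝 a) := by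
  rw [tendstoWeakly_iff_inner] at hz
  let e := stdOrthonormalBasis ℝ H
  have : Tendsto (fun i => ∑ j, ⟪e j, z i⟫_ℝ • e j) l (𝓝 (∑ j, ⟪e j, a⟫_ℝ • e j)) :=
    tendsto_finsetSum _ fun j _ => (hz (e j)).smul_const (e j)
  simpa only [OrthonormalBasis.sum_repr'] using this

theorem isCompact_toWeakSpace_image_closedBall (M : ℝ) :
    IsCompact (toWeakSpace ℝ H '' Metric.closedBall 0 M) := by
  let e := InnerProductSpace.toDual ℝ H
  let j : WeakDual ℝ H → WeakSpace ℝ H := fun F =>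
    toWeakSpace ℝ H (e.symm (WeakDual.toStrongDual F))
  have hj : Continuous j := by
    refine WeakBilin.continuous_of_continuous_eval _ fun F => ?_
    refine (WeakDual.eval_continuous (e.symm F)).congr fun G => ?_
    calc G (e.symm F) = ⟪e.symm (WeakDual.toStrongDual G), e.symm F⟫_ℝ :=
          InnerProductSpace.toDual_symm_apply.symm
      _ = ⟪e.symm F, e.symm (WeakDual.toStrongDual G)⟫_ℝ := real_inner_comm _ _
      _ = F (e.symm (WeakDual.toStrongDual G)) := InnerProductSpace.toDual_symm_apply
  convert (WeakDual.isCompact_closedBall (𝕜 := ℝ) (E := H) 0 M).image hj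
  rw [show j = toWeakSpace ℝ H ∘ e.symm ∘ WeakDual.toStrongDual from rfl, Set.image_comp,
    Set.image_comp, Set.image_preimage_eq _ WeakDual.toStrongDual.surjective,
    e.symm.image_closedBall, map_zero]

theorem nonempty_argminSet_of_quasiconvexOn {F : H → EReal} (hF : LowerSemicontinuous F)
    (hconv : QuasiconvexOn ℝ Set.univ F) {x₁ : H} {M : ℝ}
    (hbdd : ∀ x, F x ≤ F x₁ → ‖x‖ ≤ M) : (argminSet F).Nonempty := by
  have hx₁ : toWeakSpace ℝ H x₁ ∈ toWeakSpace ℝ H '' Metric.closedBall 0 M :=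
    Set.mem_image_of_mem _ (mem_closedBall_zero_iff.2 (hbdd x₁ le_rfl))
  obtain ⟨-, ⟨x, -, rfl⟩, hx⟩ := LowerSemicontinuousOn.exists_isMinOn ⟨_, hx₁⟩
    (isCompact_toWeakSpace_image_closedBall M)
    ((lowerSemicontinuous_comp_toWeakSpace_symm hF hconv).lowerSemicontinuousOn _)
  refine ⟨x, fun y => ?_⟩
  by_cases hy : F y ≤ F x₁
  · exact hx (Set.mem_image_of_mem _ (mem_closedBall_zero_iff.2 (hbdd y hy)))
  · exact (hx hx₁).trans (not_le.1 hy).le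

theorem exists_tendstoWeakly_ultrafilter (l : Ultrafilter ι) {z : ι → H} {M : ℝ}
    (hz : ∀ i, ‖z i‖ ≤ M) : ∃ a, TendstoWeakly z l a := by
  obtain ⟨-, ⟨a, -, rfl⟩, ha⟩ := (isCompact_toWeakSpace_image_closedBall M).ultrafilter_le_nhds
    (l.map fun i => toWeakSpace ℝ H (z i)) <| le_principal_iff.2 <| Filter.mem_map.2 <|
      univ_mem' fun i => Set.mem_image_of_mem _ (mem_closedBall_zero_iff.2 (hz i))
  exact ⟨a, ha⟩

theorem tendstoWeakly_of_unique_limit {l : Filter ι} {z : ι → H} {a : H} {M : ℝ}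
    (hz : ∀ i, ‖z i‖ ≤ M)
    (huniq : ∀ (l' : Ultrafilter ι) (b : H), ↑l' ≤ l → TendstoWeakly z l' b → b = a) :
    TendstoWeakly z l a := by
  refine tendsto_iff_ultrafilter _ _ _ |>.2 fun l' hl' => ?_
  obtain ⟨b, hb⟩ := exists_tendstoWeakly_ultrafilter l' hz
  exact huniq l' b hl' hb ▸ hb

theorem exists_weaklyTendsto_of_fejer {Z : Set H} (hZ : Z.Nonempty) {s : ℕ → H}
    (hs : ∀ z ∈ Z, Antitone fun i => ‖s i - z‖)
    (hlim : ∀ (l : Ultrafilter ℕ) (a : H), ↑l ≤ (atTop : Filter ℕ) → TendstoWeakly s l a → a ∈ Z) :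
    ∃ z ∈ Z, WeaklyTendsto s z := by
  obtain ⟨z₀, hz₀⟩ := hZ
  have hbdd : ∀ i, ‖s i‖ ≤ ‖s 0 - z₀‖ + ‖z₀‖ := fun i =>
    (norm_le_norm_sub_add (s i) z₀).trans (by gcongr; exact hs z₀ hz₀ (Nat.zero_le i))
  have hconv : ∀ z ∈ Z, ∃ t, Tendsto (fun i => ‖s i - z‖) atTop (𝓝 t) := fun z hz =>
    ⟨_, tendsto_atTop_ciInf (hs z hz) ⟨0, by rintro - ⟨i, rfl⟩; positivity⟩⟩
  obtain ⟨a, ha⟩ := exists_tendstoWeakly_ultrafilter (hyperfilter ℕ) hbdd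
  have haZ : a ∈ Z := hlim _ a (Nat.hyperfilter_le_atTop) ha
  refine ⟨a, haZ, tendstoWeakly_of_unique_limit hbdd fun l b hl hb => ?_⟩
  have hbZ : b ∈ Z := hlim l b hl hb
  obtain ⟨t, ht⟩ := hconv a haZ
  obtain ⟨t', ht'⟩ := hconv b hbZ
  -- `2⟪b - a, s i⟫` is, up to a constant, a difference of squared distances, hence convergent.
  obtain ⟨t₀, hinner⟩ : ∃ t₀, Tendsto (fun i => ⟪b - a, s i⟫_ℝ) atTop (𝓝 t₀) := by
    refine ⟨_, (((ht.pow 2).sub (ht'.pow 2)).add_const (‖b‖ ^ 2 - ‖a‖ ^ 2)).const_mul (1 / 2)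
      |>.congr fun i => ?_⟩
    rw [norm_sub_sq_real, norm_sub_sq_real, inner_sub_left, real_inner_comm, real_inner_comm b]
    ring
  have h1 := tendsto_nhds_unique (tendstoWeakly_iff_inner.1 hb (b - a)) (hinner.mono_left hl)
  have h2 := tendsto_nhds_unique (tendstoWeakly_iff_inner.1 ha (b - a))
    (hinner.mono_left Nat.hyperfilter_le_atTop)
  rw [← sub_eq_zero, ← inner_self_eq_zero (𝕜 := ℝ), inner_sub_right, h1, h2, sub_self]

end WeakTopology

section Prox

/-- The set of minimizers of `τ f + ½‖L · - s‖²`. For `L = id` it consists of the proximal point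
of `τ f` at `s`. -/
def proxSet {X U : Type*} [NormedAddCommGroup U] (τ : ℝ) (f : X → EReal) (L : X → U) (s : U) :
    Set X :=
  argminSet fun x => (τ : EReal) * f x + ((1 / 2 * ‖L x - s‖ ^ 2 : ℝ) : EReal)

theorem mem_proxSet_iff {X U : Type*} [NormedAddCommGroup U] {τ : ℝ} {f : X → EReal} {L : X → U}
    {s : U} {x : X} :
    x ∈ proxSet τ f L s ↔ ∀ x', (τ : EReal) * f x + ((1 / 2 * ‖L x - s‖ ^ 2 : ℝ) : EReal) ≤
      τ * f x' + ((1 / 2 * ‖L x' - s‖ ^ 2 : ℝ) : EReal) :=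
  Iff.rfl

theorem mem_proxSet_comp_sub_const {U : Type*} [NormedAddCommGroup U] {τ : ℝ} {φ : U → EReal}
    {c q s : U} : q ∈ proxSet τ (fun r => φ (r - c)) id s ↔ q - c ∈ proxSet τ φ id (s - c) := by
  refine (Equiv.subRight c).forall_congr fun r => ?_
  simp only [Equiv.subRight_apply, id, sub_sub_sub_cancel_right]

variable {X U H : Type*} [NormedAddCommGroup X] [InnerProductSpace ℝ X] [NormedAddCommGroup U]
  [InnerProductSpace ℝ U] [NormedAddCommGroup H] [InnerProductSpace ℝ H] {φ : H → EReal} {τ : ℝ}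

theorem convexOn_half_sq_norm_sub (L : X →L[ℝ] U) (s : U) :
    ConvexOn ℝ Set.univ fun x => 1 / 2 * ‖L x - s‖ ^ 2 := by
  have hdist : ConvexOn ℝ Set.univ fun x => dist (L x) s :=
    (convexOn_univ_dist s).comp_linearMap (L : X →ₗ[ℝ] U)
  simp only [← dist_eq_norm]
  exact (hdist.pow (fun _ _ => dist_nonneg) 2).smul (by norm_num)

theorem nonneg_of_forall_add_mul_nonneg {a b : ℝ} (h : ∀ t, 0 < t → t ≤ 1 → 0 ≤ a + t * b) :
    0 ≤ a := by
  have hlim : Tendsto (fun t : ℝ => a + t * b) (𝓝[>] 0) (𝓝 (a + 0 * b)) :=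
    (Continuous.tendsto (by fun_prop) 0).mono_left nhdsWithin_le_nhds
  rw [zero_mul, add_zero] at hlim
  exact ge_of_tendsto hlim (eventually_of_mem (Ioc_mem_nhdsGT one_pos) fun t ht => h t ht.1 ht.2)

namespace IsGammaZero

theorem exists_sub_mul_norm_sub_le (hφ : IsGammaZero φ) (s : H) :
    ∃ a b : ℝ, ∀ x, ((a - b * ‖x - s‖ : ℝ) : EReal) ≤ φ x := by
  obtain ⟨p, m, hp⟩ := hφ.exists_apply_eq_coe
  have hlt : ((m - 1 : ℝ) : EReal) < φ p := hp ▸ EReal.coe_lt_coe_iff.2 (sub_one_lt m)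
  obtain ⟨δ, hδ, hball⟩ := Metric.eventually_nhds_iff.1 (hφ.lsc p _ hlt)
  refine ⟨m - 1 - ‖s - p‖ / δ, 1 / δ, fun x => ?_⟩
  by_cases hx : φ x = ⊤
  · exact hx ▸ le_top
  obtain ⟨t, ht⟩ := hφ.exists_coe_of_ne_top hx
  set d := ‖x - p‖ with hd
  have hd0 : 0 ≤ d := norm_nonneg _
  -- The point at distance `δ d / (d + δ) < δ` from `p` on the segment from `p` to `x`.
  have hlt_combo := hball (y := (d / (d + δ)) • p + (δ / (d + δ)) • x) <| by
    have : (d / (d + δ)) • p + (δ / (d + δ)) • x - p = (δ / (d + δ)) • (x - p) := by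
      rw [show d / (d + δ) = 1 - δ / (d + δ) by field_simp; ring]
      module
    rw [dist_eq_norm, this, norm_smul, Real.norm_of_nonneg (by positivity), ← hd,
      div_mul_eq_mul_div, div_lt_iff₀ (by positivity)]
    nlinarith
  have hle := hlt_combo.trans_le
    (hφ.combo_le (by positivity) (by positivity) (by field_simp) hp.le ht.le)
  have htri : d ≤ ‖x - s‖ + ‖s - p‖ := norm_sub_le_norm_sub_add_norm_sub x s p
  rw [EReal.coe_lt_coe_iff, div_mul_eq_mul_div, div_mul_eq_mul_div, ← add_div,
    lt_div_iff₀ (by positivity)] at hle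
  rw [ht, EReal.coe_le_coe_iff, one_div_mul_eq_div, sub_sub, ← add_div, sub_le_iff_le_add,
    ← sub_le_iff_le_add', le_div_iff₀ hδ]
  linarith

theorem norm_sub_le_of_add_half_sq_norm_le (hφ : IsGammaZero φ) (hτ : 0 < τ) (s : H) (m : ℝ) :
    ∃ M, ∀ x, (τ : EReal) * φ x + ((1 / 2 * ‖x - s‖ ^ 2 : ℝ) : EReal) ≤ m → ‖x - s‖ ≤ M := by
  obtain ⟨a, b, hab⟩ := hφ.exists_sub_mul_norm_sub_le s
  refine ⟨1 + 2 * (|m - τ * a| + |τ * b|), fun x hx => ?_⟩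
  have h := (hab x).trans ((coe_mul_add_coe_le_coe_iff hτ).1 hx)
  rw [EReal.coe_le_coe_iff, le_div_iff₀ hτ] at h
  have hquad : 1 / 2 * ‖x - s‖ ^ 2 ≤ |m - τ * a| + |τ * b| * ‖x - s‖ := by
    have := mul_le_mul_of_nonneg_right (le_abs_self (τ * b)) (norm_nonneg (x - s))
    linarith [le_abs_self (m - τ * a)]
  by_contra! hlt
  nlinarith [abs_nonneg (m - τ * a), abs_nonneg (τ * b)]

theorem nonempty_proxSet [CompleteSpace H] (hφ : IsGammaZero φ) (hτ : 0 < τ) (s : H) :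
    (proxSet τ φ id s).Nonempty := by
  have hF := hφ.mul_add_coe hτ (convexOn_half_sq_norm_sub (.id ℝ H) s) (by fun_prop)
  obtain ⟨x₁, m, hm⟩ := hF.exists_apply_eq_coe
  obtain ⟨M, hM⟩ := hφ.norm_sub_le_of_add_half_sq_norm_le hτ s m
  refine nonempty_argminSet_of_quasiconvexOn hF.lsc hF.quasiconvexOn (x₁ := x₁) (M := M + ‖s‖)
    fun x hx => ?_
  have := hM x (hx.trans_eq hm)
  linarith [norm_le_norm_sub_add x s]

theorem exists_coe_of_mem_proxSet {U : Type*} [NormedAddCommGroup U] {L : H → U}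
    (hφ : IsGammaZero φ) (hτ : 0 < τ) {p : H} {s : U} (hp : p ∈ proxSet τ φ L s) :
    ∃ a : ℝ, φ p = a := by
  obtain ⟨x, m, hx⟩ := hφ.exists_apply_eq_coe
  have h := mem_proxSet_iff.1 hp x
  rw [hx, ← EReal.coe_mul, ← EReal.coe_add, coe_mul_add_coe_le_coe_iff hτ] at h
  exact hφ.exists_coe_of_ne_top (ne_top_of_le_ne_top (EReal.coe_ne_top _) h)

theorem inv_smul_sub_mem_subdiff (hφ : IsGammaZero φ) (hτ : 0 < τ) {p s : H}
    (hp : p ∈ proxSet τ φ id s) : τ⁻¹ • (s - p) ∈ subdiff φ p := by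
  obtain ⟨a, ha⟩ := hφ.exists_coe_of_mem_proxSet hτ hp
  intro y
  by_cases hy : φ y = ⊤
  · exact hy ▸ le_top
  obtain ⟨b, hb⟩ := hφ.exists_coe_of_ne_top hy
  have hsegment : ∀ t : ℝ, 0 < t → t ≤ 1 →
      0 ≤ τ * (b - a) - ⟪y - p, s - p⟫_ℝ + t * (1 / 2 * ‖y - p‖ ^ 2) := by
    intro t ht ht1
    have hcombo := hφ.combo_le (sub_nonneg.2 ht1) ht.le (by ring) ha.le hb.le
    have hle := (mem_proxSet_iff.1 hp _).trans
      (add_le_add_left ((coe_mul_le_coe_mul_iff hτ).2 hcombo) _)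
    have hnorm : ‖(1 - t) • p + t • y - s‖ ^ 2 =
        t ^ 2 * ‖y - p‖ ^ 2 - 2 * (t * ⟪y - p, s - p⟫_ℝ) + ‖p - s‖ ^ 2 := by
      rw [show (1 - t) • p + t • y - s = t • (y - p) - (s - p) by module, norm_sub_sq_real,
        inner_smul_left, norm_smul, mul_pow, Real.norm_eq_abs, sq_abs, norm_sub_rev s p]
      rfl
    simp only [id, ha, hnorm] at hle
    norm_cast at hle
    refine nonneg_of_mul_nonneg_right ?_ ht
    linarith
  have hmain := nonneg_of_forall_add_mul_nonneg hsegment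
  rw [ha, hb, inner_smul_right]
  norm_cast
  rw [← le_sub_iff_add_le', inv_mul_le_iff₀ hτ]
  linarith

end IsGammaZero

end Prox

section MonotoneOperators

variable {H : Type*} [NormedAddCommGroup H] [InnerProductSpace ℝ H] {A B : H → Set H}

/-- A monotone set-valued operator on a real inner product space. -/
def IsMonotoneOperator (A : H → Set H) : Prop :=
  ∀ ⦃x y u v : H⦄, u ∈ A x → v ∈ A y → 0 ≤ ⟪x - y, u - v⟫_ℝ

/-- A maximally monotone operator, encoded through Minty's theorem: a monotone operator whose
resolvent `(id + A)⁻¹` is defined everywhere. -/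
structure IsMaximallyMonotone (A : H → Set H) : Prop where
  monotone : IsMonotoneOperator A
  exists_sub_mem : ∀ s, ∃ x, s - x ∈ A x

/-- One evaluation of the two resolvents in the Douglas–Rachford algorithm for `0 ∈ A r + B r`:
`p = J_A s` and `q = J_B (2 p - s)`. Fixed points of the algorithm are the `s` with `p = q`; then
`p` is a zero of `A + B`. -/
structure IsDouglasRachfordStep (A B : H → Set H) (s p q : H) : Prop where
  left : s - p ∈ A p
  right : (2 : ℝ) • p - s - q ∈ B q

namespace IsDouglasRachfordStep

theorem sq_norm_sub_le_inner (hA : IsMonotoneOperator A) (hB : IsMonotoneOperator B)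
    {s p q s' p' q' : H} (h : IsDouglasRachfordStep A B s p q)
    (h' : IsDouglasRachfordStep A B s' p' q') :
    ‖(p - q) - (p' - q')‖ ^ 2 ≤ ⟪(p - q) - (p' - q'), s - s'⟫_ℝ := by
  have h₁ := hA h.left h'.left
  have h₂ := hB h.right h'.right
  set a := s - s'
  set b := p - p'
  set e := (p - q) - (p' - q')
  rw [show s - p - (s' - p') = a - b by simp only [a, b]; abel] at h₁
  rw [show q - q' = b - e by simp only [b, e]; abel,
    show (2 : ℝ) • p - s - q - ((2 : ℝ) • p' - s' - q') = b - a + e by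
      simp only [a, b, e]; module] at h₂
  rw [← real_inner_self_eq_norm_sq]
  simp only [inner_sub_left, inner_sub_right, inner_add_right, real_inner_comm] at h₁ h₂ ⊢
  linarith [real_inner_comm b e]

theorem norm_sub_le (hA : IsMonotoneOperator A) {s p q s' p' q' : H}
    (h : IsDouglasRachfordStep A B s p q) (h' : IsDouglasRachfordStep A B s' p' q') :
    ‖p - p'‖ ≤ ‖s - s'‖ := by
  have h₁ := hA h.left h'.left
  rw [sub_sub_sub_comm, inner_sub_right, real_inner_self_eq_norm_sq] at h₁
  have h₂ := real_inner_le_norm (p - p') (s - s')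
  by_contra! hlt
  nlinarith [norm_nonneg (s - s')]

theorem eq_of_eq (hA : IsMonotoneOperator A) {s p q p' q' : H}
    (h : IsDouglasRachfordStep A B s p q) (h' : IsDouglasRachfordStep A B s p' q') : p = p' := by
  simpa only [sub_self, norm_zero, norm_le_zero_iff, sub_eq_zero] using h.norm_sub_le hA h'

theorem sq_norm_sub_add_le (hA : IsMonotoneOperator A) (hB : IsMonotoneOperator B) {s p q z r : H}
    (h : IsDouglasRachfordStep A B s p q) (hz : IsDouglasRachfordStep A B z r r) {ρ : ℝ}
    (hρ : 0 ≤ ρ) :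
    ‖s - ρ • (p - q) - z‖ ^ 2 + ρ * (2 - ρ) * ‖p - q‖ ^ 2 ≤ ‖s - z‖ ^ 2 := by
  have hfirm := h.sq_norm_sub_le_inner hA hB hz
  rw [sub_self, sub_zero, real_inner_comm] at hfirm
  rw [sub_right_comm, norm_sub_sq_real, inner_smul_right, norm_smul, mul_pow, Real.norm_eq_abs,
    sq_abs]
  nlinarith

theorem norm_sub_le_of_update (hA : IsMonotoneOperator A) (hB : IsMonotoneOperator B)
    {s p q s' p' q' : H} (h : IsDouglasRachfordStep A B s p q)
    (h' : IsDouglasRachfordStep A B s' p' q') {ρ : ℝ} (hρ : ρ ∈ Set.Icc (0 : ℝ) 2)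
    (hs' : s' = s - ρ • (p - q)) : ‖p' - q'‖ ≤ ‖p - q‖ := by
  have hfirm := h.sq_norm_sub_le_inner hA hB h'
  rw [hs', sub_sub_cancel, inner_smul_right] at hfirm
  set d := p - q
  set e := d - (p' - q') with he
  have hd' : p' - q' = d - e := by rw [he, sub_sub_cancel]
  have hinner : ‖e‖ ^ 2 ≤ 2 * ⟪d, e⟫_ℝ := by
    rw [real_inner_comm] at hfirm
    have hde : 0 ≤ ⟪d, e⟫_ℝ := by
      by_contra! hneg
      have he0 : ‖e‖ ^ 2 ≤ 0 := hfirm.trans (mul_nonpos_of_nonneg_of_nonpos hρ.1 hneg.le)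
      rw [sq_nonpos_iff, norm_eq_zero] at he0
      simp [he0] at hneg
    exact hfirm.trans (mul_le_mul_of_nonneg_right hρ.2 hde)
  rw [hd', ← pow_le_pow_iff_left₀ (norm_nonneg _) (norm_nonneg _) two_ne_zero, norm_sub_sq_real]
  linarith

end IsDouglasRachfordStep

theorem IsMonotoneOperator.inner_add_inner_nonneg_of_tendstoWeakly [CompleteSpace H]
    (hA : IsMonotoneOperator A) (hB : IsMonotoneOperator B) {ι : Type*} {l : Filter ι} [l.NeBot]
    {p q u v : ι → H} {p₀ q₀ u₀ v₀ : H} (hu : ∀ i, u i ∈ A (p i)) (hv : ∀ i, v i ∈ B (q i))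
    (hp₀ : TendstoWeakly p l p₀) (hu₀ : TendstoWeakly u l u₀) (hq₀ : TendstoWeakly q l q₀)
    (hv₀ : TendstoWeakly v l v₀)
    (hcross : Tendsto (fun i => ⟪p i, u i⟫_ℝ + ⟪q i, v i⟫_ℝ) l (𝓝 (⟪p₀, u₀⟫_ℝ + ⟪q₀, v₀⟫_ℝ)))
    {x y u' v' : H} (hu' : u' ∈ A x) (hv' : v' ∈ B y) :
    0 ≤ ⟪p₀ - x, u₀ - u'⟫_ℝ + ⟪q₀ - y, v₀ - v'⟫_ℝ := by
  have expand : ∀ a b c d : H, ⟪a - x, b - u'⟫_ℝ + ⟪c - y, d - v'⟫_ℝ =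
      ⟪a, b⟫_ℝ + ⟪c, d⟫_ℝ - (⟪u', a⟫_ℝ + ⟪x, b⟫_ℝ + ⟪v', c⟫_ℝ + ⟪y, d⟫_ℝ) +
        (⟪x, u'⟫_ℝ + ⟪y, v'⟫_ℝ) := fun a b c d => by
    simp only [inner_sub_left, inner_sub_right, real_inner_comm a u', real_inner_comm c v']
    ring
  rw [tendstoWeakly_iff_inner] at hp₀ hu₀ hq₀ hv₀
  refine ge_of_tendsto' (x := l) (f := fun i => ⟪p i - x, u i - u'⟫_ℝ + ⟪q i - y, v i - v'⟫_ℝ) ?_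
    fun i => add_nonneg (hA (hu i) hu') (hB (hv i) hv')
  simp only [expand]
  exact (hcross.sub ((((hp₀ u').add (hu₀ x)).add (hq₀ v')).add (hv₀ y))).add_const _

theorem IsDouglasRachfordStep.of_tendstoWeakly [CompleteSpace H] (hA : IsMaximallyMonotone A)
    (hB : IsMaximallyMonotone B) {ι : Type*} {l : Filter ι} [l.NeBot] {s p q : ι → H} {z r : H}
    {M : ℝ} (h : ∀ i, IsDouglasRachfordStep A B (s i) (p i) (q i)) (hM : ∀ i, ‖s i‖ ≤ M)
    (hs : TendstoWeakly s l z) (hp : TendstoWeakly p l r)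
    (hpq : Tendsto (fun i => p i - q i) l (𝓝 0)) : IsDouglasRachfordStep A B z r r := by
  have hq : TendstoWeakly q l r := by
    simpa only [sub_sub_cancel, sub_zero] using hp.sub (.of_tendsto hpq)
  have hcross : Tendsto (fun i => ⟪p i, s i - p i⟫_ℝ + ⟪q i, (2 : ℝ) • p i - s i - q i⟫_ℝ) l
      (𝓝 (⟪r, z - r⟫_ℝ + ⟪r, (2 : ℝ) • r - z - r⟫_ℝ)) := by
    have h₁ : Tendsto (fun i => ⟪p i - q i, s i⟫_ℝ) l (𝓝 0) := by
      refine squeeze_zero_norm (a := fun i => ‖p i - q i‖ * M) (fun i => ?_) ?_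
      · exact (norm_inner_le_norm _ _).trans (by gcongr; exact hM i)
      · simpa only [norm_zero, zero_mul] using hpq.norm.mul_const M
    have h₂ : Tendsto (fun i => ⟪p i - q i, p i - q i⟫_ℝ) l (𝓝 0) := by
      simpa only [inner_zero_left] using hpq.inner hpq
    convert h₁.sub h₂ using 2 with i
    · simp only [inner_sub_left, inner_sub_right, inner_smul_right, real_inner_comm]
      ring
    · rw [← inner_add_right, show z - r + ((2 : ℝ) • r - z - r) = 0 by module, inner_zero_right,
        sub_zero]
  -- Testing monotonicity at the resolvents of the limits leaves `0 ≤ -‖r - x‖² - ‖r - y‖²`.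
  obtain ⟨x, hx⟩ := hA.exists_sub_mem z
  obtain ⟨y, hy⟩ := hB.exists_sub_mem ((2 : ℝ) • r - z)
  have hnonneg := hA.monotone.inner_add_inner_nonneg_of_tendstoWeakly hB.monotone
    (fun i => (h i).left) (fun i => (h i).right) hp (hs.sub hp) hq
    (((hp.const_smul 2).sub hs).sub hq) hcross hx hy
  rw [sub_sub_sub_cancel_left, sub_sub_sub_cancel_left, ← neg_sub r x, ← neg_sub r y,
    inner_neg_right, inner_neg_right, real_inner_self_eq_norm_sq, real_inner_self_eq_norm_sq]
    at hnonneg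
  have hrx : r = x := by
    rw [← sub_eq_zero, ← norm_eq_zero, ← sq_nonpos_iff]
    nlinarith [sq_nonneg ‖r - y‖]
  have hry : r = y := by
    rw [← sub_eq_zero, ← norm_eq_zero, ← sq_nonpos_iff]
    nlinarith [sq_nonneg ‖r - x‖]
  exact ⟨hrx ▸ hx, by rwa [← hry] at hy⟩

theorem tendsto_zero_of_antitone_of_sum_mul_le {d w : ℕ → ℝ} (hd : Antitone d)
    (hd0 : ∀ i, 0 ≤ d i) (hw0 : ∀ i, 0 ≤ w i)
    (hw : Tendsto (fun n => ∑ i ∈ Finset.range n, w i) atTop atTop) {C : ℝ}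
    (hC : ∀ n, ∑ i ∈ Finset.range n, w i * d i ≤ C) : Tendsto d atTop (𝓝 0) := by
  refine tendsto_order.2 ⟨fun a ha => .of_forall fun i => ha.trans_le (hd0 i), fun ε hε => ?_⟩
  by_contra hcon
  have hge : ∀ i, ε ≤ d i := fun i => by
    by_contra! hlt
    exact hcon ((eventually_ge_atTop i).mono fun j hj => (hd hj).trans_lt hlt)
  obtain ⟨n, hn⟩ := (hw.eventually_gt_atTop (C / ε)).exists
  rw [div_lt_iff₀ hε, Finset.sum_mul] at hn
  exact hn.not_ge ((Finset.sum_le_sum fun i _ =>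
    mul_le_mul_of_nonneg_left (hge i) (hw0 i)).trans (hC n))

section Convergence

variable {ρ : ℕ → ℝ} {s p q : ℕ → H}

theorem IsDouglasRachfordStep.antitone_norm_sub (hA : IsMonotoneOperator A)
    (hB : IsMonotoneOperator B) (hρ : ∀ i, ρ i ∈ Set.Icc (0 : ℝ) 2)
    (hstep : ∀ i, IsDouglasRachfordStep A B (s i) (p i) (q i))
    (hupdate : ∀ i, s (i + 1) = s i - ρ i • (p i - q i)) {z r : H}
    (hz : IsDouglasRachfordStep A B z r r) : Antitone fun i => ‖s i - z‖ := by
  refine antitone_nat_of_succ_le fun i => ?_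
  have hfejer := (hstep i).sq_norm_sub_add_le hA hB hz (hρ i).1
  rw [← hupdate] at hfejer
  have hgap : 0 ≤ ρ i * (2 - ρ i) * ‖p i - q i‖ ^ 2 :=
    mul_nonneg (mul_nonneg (hρ i).1 (sub_nonneg.2 (hρ i).2)) (sq_nonneg _)
  exact pow_le_pow_iff_left₀ (norm_nonneg _) (norm_nonneg _) two_ne_zero |>.1 (by linarith)

theorem IsDouglasRachfordStep.tendsto_sub_zero (hA : IsMonotoneOperator A)
    (hB : IsMonotoneOperator B) (hρ : ∀ i, ρ i ∈ Set.Icc (0 : ℝ) 2)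
    (hρ_sum : Tendsto (fun n => ∑ i ∈ Finset.range n, ρ i * (2 - ρ i)) atTop atTop)
    (hstep : ∀ i, IsDouglasRachfordStep A B (s i) (p i) (q i))
    (hupdate : ∀ i, s (i + 1) = s i - ρ i • (p i - q i)) {z r : H}
    (hz : IsDouglasRachfordStep A B z r r) : Tendsto (fun i => p i - q i) atTop (𝓝 0) := by
  have hanti : Antitone fun i => ‖p i - q i‖ ^ 2 := antitone_nat_of_succ_le fun i => by
    have := (hstep i).norm_sub_le_of_update hA hB (hstep (i + 1)) (hρ i) (hupdate i)
    gcongr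
  have hsum : ∀ n, ∑ i ∈ Finset.range n, ρ i * (2 - ρ i) * ‖p i - q i‖ ^ 2 ≤
      ‖s 0 - z‖ ^ 2 - ‖s n - z‖ ^ 2 := fun n => by
    rw [← Finset.sum_range_sub' fun i => ‖s i - z‖ ^ 2]
    refine Finset.sum_le_sum fun i _ => le_sub_iff_add_le'.2 ?_
    rw [hupdate]
    exact (hstep i).sq_norm_sub_add_le hA hB hz (hρ i).1
  have hlim := tendsto_zero_of_antitone_of_sum_mul_le hanti (fun i => sq_nonneg _)
    (fun i => mul_nonneg (hρ i).1 (sub_nonneg.2 (hρ i).2)) hρ_sum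
    fun n => (hsum n).trans (sub_le_self _ (sq_nonneg _))
  rw [tendsto_zero_iff_norm_tendsto_zero]
  simpa only [Real.sqrt_sq (norm_nonneg _), Real.sqrt_zero] using hlim.sqrt

theorem IsDouglasRachfordStep.exists_weaklyTendsto [CompleteSpace H] (hA : IsMaximallyMonotone A)
    (hB : IsMaximallyMonotone B) (hρ : ∀ i, ρ i ∈ Set.Icc (0 : ℝ) 2)
    (hρ_sum : Tendsto (fun n => ∑ i ∈ Finset.range n, ρ i * (2 - ρ i)) atTop atTop)
    (hstep : ∀ i, IsDouglasRachfordStep A B (s i) (p i) (q i))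
    (hupdate : ∀ i, s (i + 1) = s i - ρ i • (p i - q i))
    (hne : ∃ z r, IsDouglasRachfordStep A B z r r) :
    ∃ z r, IsDouglasRachfordStep A B z r r ∧ WeaklyTendsto s z ∧ WeaklyTendsto p r ∧
      Tendsto (fun i => p i - q i) atTop (𝓝 0) := by
  obtain ⟨z₀, r₀, h₀⟩ := hne
  have hanti : ∀ {z r}, IsDouglasRachfordStep A B z r r → Antitone fun i => ‖s i - z‖ :=
    antitone_norm_sub hA.monotone hB.monotone hρ hstep hupdate
  have hpq : Tendsto (fun i => p i - q i) atTop (𝓝 0) :=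
    tendsto_sub_zero hA.monotone hB.monotone hρ hρ_sum hstep hupdate h₀
  have hs_bdd : ∀ i, ‖s i‖ ≤ ‖s 0 - z₀‖ + ‖z₀‖ := fun i =>
    (norm_le_norm_sub_add (s i) z₀).trans (by gcongr; exact hanti h₀ (Nat.zero_le i))
  have hp_bdd : ∀ i, ‖p i‖ ≤ ‖s 0 - z₀‖ + ‖r₀‖ := fun i =>
    (norm_le_norm_sub_add (p i) r₀).trans
      (by gcongr; exact ((hstep i).norm_sub_le hA.monotone h₀).trans (hanti h₀ (Nat.zero_le i)))
  have hlim : ∀ (l : Ultrafilter ℕ) {a b : H}, ↑l ≤ (atTop : Filter ℕ) → TendstoWeakly s l a →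
      TendstoWeakly p l b → IsDouglasRachfordStep A B a b b := fun l a b hl ha hb =>
    of_tendstoWeakly hA hB hstep hs_bdd ha hb (hpq.mono_left hl)
  obtain ⟨z, ⟨r, hz⟩, hsz⟩ := exists_weaklyTendsto_of_fejer
    (Z := {z | ∃ r, IsDouglasRachfordStep A B z r r}) ⟨z₀, r₀, h₀⟩
    (fun z ⟨r, hz⟩ => hanti hz) fun l a hl ha =>
      let ⟨b, hb⟩ := exists_tendstoWeakly_ultrafilter l hp_bdd
      ⟨b, hlim l hl ha hb⟩
  refine ⟨z, r, hz, hsz, tendstoWeakly_of_unique_limit hp_bdd fun l b hl hb => ?_, hpq⟩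
  exact (hlim l hl (hsz.mono_left hl) hb).eq_of_eq hA.monotone hz

end Convergence

end MonotoneOperators

section Subdifferential

open scoped Pointwise

variable {H : Type*} [NormedAddCommGroup H] [InnerProductSpace ℝ H] {φ ψ : H → EReal}

theorem mem_subdiff_comp_sub_const {c r w : H} :
    w ∈ subdiff (fun r => φ (r - c)) r ↔ w ∈ subdiff φ (r - c) := by
  refine (Equiv.subRight c).forall_congr fun z => ?_
  rw [Equiv.subRight_apply, sub_sub_sub_cancel_right]

theorem fenchelConj_comp_sub_const (c u : H) :
    fenchelConj (fun r => φ (r - c)) u = fenchelConj φ u + ((⟪u, c⟫_ℝ : ℝ) : EReal) := by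
  refine eq_of_forall_ge_iff fun b => ?_
  rw [← EReal.le_sub_iff_add_le (.inl (EReal.coe_ne_bot _)) (.inl (EReal.coe_ne_top _))]
  simp only [fenchelConj, iSup_le_iff]
  refine (Equiv.subRight c).forall_congr fun r => ?_
  rw [Equiv.subRight_apply, inner_sub_right, EReal.coe_sub,
    EReal.le_sub_iff_add_le (.inl (EReal.coe_ne_bot _)) (.inl (EReal.coe_ne_top _)),
    sub_eq_add_neg _ (φ _), sub_eq_add_neg _ (φ _), add_right_comm, EReal.sub_add_cancel]

theorem le_fenchelConj {x : H} {a : ℝ} (hx : φ x = a) (v : H) :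
    ((⟪v, x⟫_ℝ - a : ℝ) : EReal) ≤ fenchelConj φ v := by
  have := le_iSup (fun x : H => ((⟪v, x⟫_ℝ : ℝ) : EReal) - φ x) x
  rwa [hx, ← EReal.coe_sub] at this

namespace IsGammaZero

theorem exists_coe_of_mem_subdiff (hφ : IsGammaZero φ) {x u : H} (hu : u ∈ subdiff φ x) :
    ∃ a : ℝ, φ x = a := by
  obtain ⟨z, b, hz⟩ := hφ.exists_apply_eq_coe
  refine hφ.exists_coe_of_ne_top fun hx => ?_
  have := hu z
  rw [hx, EReal.top_add_coe, hz, top_le_iff] at this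
  exact EReal.coe_ne_top b this

theorem isMonotoneOperator_subdiff (hφ : IsGammaZero φ) : IsMonotoneOperator (subdiff φ) := by
  intro x y u v hu hv
  obtain ⟨a, ha⟩ := hφ.exists_coe_of_mem_subdiff hu
  obtain ⟨b, hb⟩ := hφ.exists_coe_of_mem_subdiff hv
  have hxy := hu y
  have hyx := hv x
  rw [ha, hb] at hxy hyx
  norm_cast at hxy hyx
  rw [← neg_sub x y, inner_neg_left] at hxy
  rw [inner_sub_right]
  linarith

theorem sub_mem_smul_subdiff {τ : ℝ} (hφ : IsGammaZero φ) (hτ : 0 < τ) {p s : H}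
    (hp : p ∈ proxSet τ φ id s) : s - p ∈ τ • subdiff φ p :=
  (Set.mem_smul_set_iff_inv_smul_mem₀ hτ.ne' _ _).2 (hφ.inv_smul_sub_mem_subdiff hτ hp)

theorem isMaximallyMonotone_smul_subdiff [CompleteSpace H] {τ : ℝ} (hφ : IsGammaZero φ)
    (hτ : 0 < τ) : IsMaximallyMonotone fun p => τ • subdiff φ p := by
  refine ⟨?_, fun s => ?_⟩
  · rintro x y - - ⟨u, hu, rfl⟩ ⟨v, hv, rfl⟩
    rw [← smul_sub, inner_smul_right]
    exact mul_nonneg hτ.le (hφ.isMonotoneOperator_subdiff hu hv)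
  · obtain ⟨p, hp⟩ := hφ.nonempty_proxSet hτ s
    exact ⟨p, hφ.sub_mem_smul_subdiff hτ hp⟩

theorem fenchelConj_eq_of_mem_subdiff (hφ : IsGammaZero φ) {x v : H} {a : ℝ} (hx : φ x = a)
    (hv : v ∈ subdiff φ x) : fenchelConj φ v = ((⟪v, x⟫_ℝ - a : ℝ) : EReal) := by
  refine le_antisymm (iSup_le fun z => ?_) (le_fenchelConj hx v)
  by_cases hz : φ z = ⊤
  · rw [hz, EReal.sub_top]
    exact bot_le
  obtain ⟨b, hb⟩ := hφ.exists_coe_of_ne_top hz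
  have hineq := hv z
  rw [hx, hb, inner_sub_left, real_inner_comm, real_inner_comm v x] at hineq
  rw [hb]
  norm_cast at hineq ⊢
  linarith

end IsGammaZero

section FenchelPair

/-- Kuhn–Tucker pairs of the problem of minimizing `φ + ψ`: then `r` is a primal and `-w` a dual
solution. -/
structure IsFenchelPair (φ ψ : H → EReal) (r w : H) : Prop where
  left : w ∈ subdiff φ r
  right : -w ∈ subdiff ψ r

variable {r w : H}

theorem IsFenchelPair.mem_argminSet_add (h : IsFenchelPair φ ψ r w) (hφ : IsGammaZero φ)
    (hψ : IsGammaZero ψ) : r ∈ argminSet fun r => φ r + ψ r := by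
  obtain ⟨a, ha⟩ := hφ.exists_coe_of_mem_subdiff h.left
  obtain ⟨b, hb⟩ := hψ.exists_coe_of_mem_subdiff h.right
  intro z
  refine le_trans (le_of_eq ?_) (add_le_add (h.left z) (h.right z))
  simp only [ha, hb, inner_neg_right]
  norm_cast
  ring

theorem IsFenchelPair.neg_mem_argminSet_fenchelConj (h : IsFenchelPair φ ψ r w)
    (hφ : IsGammaZero φ) (hψ : IsGammaZero ψ) :
    -w ∈ argminSet fun u => fenchelConj φ (-u) + fenchelConj ψ u := by
  obtain ⟨a, ha⟩ := hφ.exists_coe_of_mem_subdiff h.left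
  obtain ⟨b, hb⟩ := hψ.exists_coe_of_mem_subdiff h.right
  intro u
  refine le_trans (le_of_eq ?_) (add_le_add (le_fenchelConj ha (-u)) (le_fenchelConj hb u))
  simp only [neg_neg, hφ.fenchelConj_eq_of_mem_subdiff ha h.left,
    hψ.fenchelConj_eq_of_mem_subdiff hb h.right, inner_neg_left]
  norm_cast
  ring

theorem isDouglasRachfordStep_iff_isFenchelPair {τ : ℝ} (hτ : 0 < τ) :
    IsDouglasRachfordStep (fun p => τ • subdiff φ p) (fun p => τ • subdiff ψ p) (r + τ • w) r r ↔
      IsFenchelPair φ ψ r w := by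
  have hright : (2 : ℝ) • r - (r + τ • w) - r = τ • -w := by module
  constructor
  · rintro ⟨hl, hr⟩
    rw [add_sub_cancel_left, Set.smul_mem_smul_set_iff₀ hτ.ne'] at hl
    rw [hright, Set.smul_mem_smul_set_iff₀ hτ.ne'] at hr
    exact ⟨hl, hr⟩
  · rintro ⟨hl, hr⟩
    refine ⟨?_, ?_⟩
    · rw [add_sub_cancel_left]
      exact Set.smul_mem_smul_set hl
    · rw [hright]
      exact Set.smul_mem_smul_set hr

theorem IsFenchelPair.exists_weaklyTendsto_of_mem_proxSet [CompleteSpace H] (hφ : IsGammaZero φ)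
    (hψ : IsGammaZero ψ) {τ : ℝ} (hτ : 0 < τ) {ρ : ℕ → ℝ} (hρ : ∀ i, ρ i ∈ Set.Icc (0 : ℝ) 2)
    (hρ_sum : Tendsto (fun n => ∑ i ∈ Finset.range n, ρ i * (2 - ρ i)) atTop atTop)
    {s p q : ℕ → H} (hp : ∀ i, p i ∈ proxSet τ φ id (s i))
    (hq : ∀ i, q i ∈ proxSet τ ψ id ((2 : ℝ) • p i - s i))
    (hupdate : ∀ i, s (i + 1) = s i - ρ i • (p i - q i)) (h₀ : IsFenchelPair φ ψ r w) :
    ∃ r w, IsFenchelPair φ ψ r w ∧ WeaklyTendsto s (r + τ • w) ∧ WeaklyTendsto p r ∧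
      Tendsto (fun i => p i - q i) atTop (𝓝 0) := by
  obtain ⟨z, r, hstep, hs, hpr, hpq⟩ := IsDouglasRachfordStep.exists_weaklyTendsto
    (hφ.isMaximallyMonotone_smul_subdiff hτ) (hψ.isMaximallyMonotone_smul_subdiff hτ) hρ hρ_sum
    (fun i => ⟨hφ.sub_mem_smul_subdiff hτ (hp i), hψ.sub_mem_smul_subdiff hτ (hq i)⟩) hupdate
    ⟨_, _, (isDouglasRachfordStep_iff_isFenchelPair hτ).2 h₀⟩
  obtain ⟨w, rfl⟩ : ∃ w, z = r + τ • w := ⟨τ⁻¹ • (z - r), by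
    rw [smul_inv_smul₀ hτ.ne', add_sub_cancel]⟩
  exact ⟨r, w, (isDouglasRachfordStep_iff_isFenchelPair hτ).1 hstep, hs, hpr, hpq⟩

end FenchelPair

end Subdifferential

section Postcomposition

section Exactness

variable {X U : Type*} {L : X → U} {f : X → EReal}

theorem infPostcomp_apply_le (L : X → U) (f : X → EReal) (x : X) :
    infPostcomp L f (L x) ≤ f x :=
  iInf₂_le (f := fun x' (_ : L x' = L x) => f x') x rfl

theorem IsExactPostcomp.exists_eq (h : IsExactPostcomp L f) {r : U} (hr : infPostcomp L f r ≠ ⊤) :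
    ∃ x, L x = r ∧ f x = infPostcomp L f r := by
  obtain ⟨x, hx, -⟩ : ∃ x, L x = r ∧ f x ≠ ⊤ := by
    simpa only [infPostcomp, ne_eq, iInf_eq_top, not_forall, exists_prop] using hr
  obtain ⟨x', hx', hmin⟩ := h r ⟨x, hx⟩
  exact ⟨x', hx', le_antisymm (le_iInf₂ hmin) (hx' ▸ infPostcomp_apply_le L f x')⟩

theorem IsExactPostcomp.mem_proxSet_iff [NormedAddCommGroup U] (h : IsExactPostcomp L f) {τ : ℝ}
    (hτ : 0 < τ) {s : U} {x : X} :
    x ∈ proxSet τ f L s ↔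
      L x ∈ proxSet τ (infPostcomp L f) id s ∧ f x = infPostcomp L f (L x) := by
  constructor
  · intro hx
    constructor
    · intro r
      by_cases hr : infPostcomp L f r = ⊤
      · simp only [hr, EReal.coe_mul_top_of_pos hτ, EReal.top_add_coe, le_top]
      obtain ⟨x', rfl, hx'⟩ := h.exists_eq hr
      simp only [← hx', id]
      refine le_trans ?_ (hx x')
      exact (coe_mul_add_coe_le_coe_mul_add_coe_iff hτ).2 (infPostcomp_apply_le L f x)
    · refine le_antisymm (le_iInf₂ fun x' hx' => ?_) (infPostcomp_apply_le L f x)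
      have := _root_.mem_proxSet_iff.1 hx x'
      rwa [hx', coe_mul_add_coe_le_coe_mul_add_coe_iff hτ] at this
  · rintro ⟨hmin, hx⟩ x'
    simp only [hx]
    exact (hmin (L x')).trans
      ((coe_mul_add_coe_le_coe_mul_add_coe_iff hτ).2 (infPostcomp_apply_le L f x'))

end Exactness

variable {X U : Type*} [NormedAddCommGroup X] [InnerProductSpace ℝ X]
  [NormedAddCommGroup U] [InnerProductSpace ℝ U] {f : X → EReal} {L : X →L[ℝ] U}

theorem IsExactPostcomp.isGammaZero (hLf : IsExactPostcomp L f) (hf : IsGammaZero f)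
    (hlsc : LowerSemicontinuous (infPostcomp L f)) : IsGammaZero (infPostcomp L f) := by
  refine .of_combo_le (fun r hr => ?_) ?_ (fun r r' a b s t ha hb hab hr hr' => ?_) hlsc
  · obtain ⟨x, -, hx⟩ := hLf.exists_eq (hr.trans_ne bot_ne_top)
    exact hf.ne_bot x (hx.trans hr)
  · obtain ⟨x, hx⟩ := hf.proper
    exact ⟨L x, ne_top_of_le_ne_top hx (infPostcomp_apply_le L f x)⟩
  · obtain ⟨x, rfl, hx⟩ := hLf.exists_eq (ne_top_of_le_ne_top (EReal.coe_ne_top s) hr)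
    obtain ⟨x', rfl, hx'⟩ := hLf.exists_eq (ne_top_of_le_ne_top (EReal.coe_ne_top t) hr')
    rw [← map_smul, ← map_smul, ← map_add]
    exact (infPostcomp_apply_le L f _).trans
      (hf.combo_le ha.le hb.le hab (hx.trans_le hr) (hx'.trans_le hr'))

theorem IsExactPostcomp.nonempty_proxSet [CompleteSpace U] {τ : ℝ} (hLf : IsExactPostcomp L f)
    (hφ : IsGammaZero (infPostcomp L f)) (hτ : 0 < τ) (s : U) : (proxSet τ f L s).Nonempty := by
  obtain ⟨r, hr⟩ := hφ.nonempty_proxSet hτ s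
  obtain ⟨a, ha⟩ := hφ.exists_coe_of_mem_proxSet hτ hr
  obtain ⟨x, rfl, hx⟩ := hLf.exists_eq (ha.trans_ne (EReal.coe_ne_top a))
  exact ⟨x, (hLf.mem_proxSet_iff hτ).2 ⟨hr, hx⟩⟩

variable [CompleteSpace X] [CompleteSpace U]

theorem mem_subdiff_infPostcomp {x : X} {w : U} (hw : L.adjoint w ∈ subdiff f x) :
    w ∈ subdiff (infPostcomp L f) (L x) := by
  refine fun r => le_iInf₂ fun x' hx' => ?_
  have := hw x'
  rw [ContinuousLinearMap.adjoint_inner_right, map_sub, hx'] at this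
  exact (add_le_add_left (infPostcomp_apply_le L f x) _).trans this

theorem fenchelConj_infPostcomp (u : U) :
    fenchelConj (infPostcomp L f) u = fenchelConj f (L.adjoint u) := by
  refine eq_of_forall_ge_iff fun b => ?_
  simp only [fenchelConj, iSup_le_iff, infPostcomp, coe_sub_le_comm (b := b), le_iInf_iff,
    ContinuousLinearMap.adjoint_inner_left]
  exact ⟨fun h x => h _ x rfl, fun h r x hx => hx ▸ h x⟩

end Postcomposition

section WellPosedness

variable {X U ι : Type*} [NormedAddCommGroup X] [InnerProductSpace ℝ X] [NormedAddCommGroup U]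
  [InnerProductSpace ℝ U] {l : Filter ι}

theorem exists_mem_sphere_le_of_quasiconvexOn {F : X → EReal} (hconv : QuasiconvexOn ℝ Set.univ F)
    {x₀ x : X} (hx : F x₀ ≤ F x) {δ : ℝ} (hδ : 0 < δ) (hδx : δ ≤ ‖x - x₀‖) :
    ∃ z ∈ Metric.sphere x₀ δ, F z ≤ F x := by
  have hpos : 0 < ‖x - x₀‖ := hδ.trans_le hδx
  obtain ⟨t, ht0, ht1, ht⟩ : ∃ t, 0 ≤ t ∧ t ≤ 1 ∧ t * ‖x - x₀‖ = δ :=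
    ⟨δ / ‖x - x₀‖, by positivity, (div_le_one hpos).2 hδx, div_mul_cancel₀ _ hpos.ne'⟩
  refine ⟨(1 - t) • x₀ + t • x, ?_, (hconv (F x) ⟨Set.mem_univ _, hx⟩ ⟨Set.mem_univ _, le_rfl⟩
    (sub_nonneg.2 ht1) ht0 (sub_add_cancel 1 t)).2⟩
  rw [mem_sphere_iff_norm, show (1 - t) • x₀ + t • x - x₀ = t • (x - x₀) by module, norm_smul,
    Real.norm_of_nonneg ht0, ht]

theorem tendsto_of_subsingleton_argminSet [FiniteDimensional ℝ X] {F : X → EReal}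
    (hF : LowerSemicontinuous F) (hconv : QuasiconvexOn ℝ Set.univ F) {x₀ : X}
    (hx₀ : x₀ ∈ argminSet F) (huniq : (argminSet F).Subsingleton) {x : ι → X}
    (hx : Tendsto (fun i => F (x i)) l (𝓝 (F x₀))) : Tendsto x l (𝓝 x₀) := by
  refine Metric.tendsto_nhds.2 fun δ hδ => ?_
  have hsphere : ∀ i, δ ≤ dist (x i) x₀ → ∃ z ∈ Metric.sphere x₀ δ, F z ≤ F (x i) := fun i hi =>
    exists_mem_sphere_le_of_quasiconvexOn hconv (hx₀ _) hδ (dist_eq_norm (x i) x₀ ▸ hi)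
  rcases (Metric.sphere x₀ δ).eq_empty_or_nonempty with hempty | hne
  · refine .of_forall fun i => ?_
    by_contra! hi
    obtain ⟨z, hz, -⟩ := hsphere i hi
    exact (hempty ▸ hz : z ∈ (∅ : Set X))
  obtain ⟨z₀, hz₀, hmin⟩ := (hF.lowerSemicontinuousOn _).exists_isMinOn hne
    (isCompact_sphere x₀ δ)
  have hlt : F x₀ < F z₀ := by
    refine (hx₀ z₀).lt_of_not_ge fun hle => hδ.ne ?_
    rw [← hz₀, huniq (fun x' => hle.trans (hx₀ x')) hx₀, dist_self]
  filter_upwards [hx.eventually_lt_const hlt] with i hi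
  by_contra! hδi
  obtain ⟨z, hz, hle⟩ := hsphere i hδi
  exact (hle.trans_lt hi).not_ge (hmin hz)

theorem IsGammaZero.tendsto_of_mem_proxSet [FiniteDimensional ℝ X] {f : X → EReal}
    (hf : IsGammaZero f) {τ : ℝ} (hτ : 0 < τ) {L : X →L[ℝ] U} {s : ι → U} {s₀ r : U} {x : ι → X}
    {x₀ : X} (hx : ∀ i, x i ∈ proxSet τ f L (s i)) (hx₀ : x₀ ∈ proxSet τ f L s₀)
    (huniq : (proxSet τ f L s₀).Subsingleton) (hs : Tendsto s l (𝓝 s₀))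
    (hLx : Tendsto (fun i => L (x i)) l (𝓝 r)) : Tendsto x l (𝓝 x₀) := by
  have hF := hf.mul_add_coe hτ (convexOn_half_sq_norm_sub L s₀) (by fun_prop)
  choose a ha using fun i => hf.exists_coe_of_mem_proxSet hτ (hx i)
  obtain ⟨a₀, ha₀⟩ := hf.exists_coe_of_mem_proxSet hτ hx₀
  refine tendsto_of_subsingleton_argminSet hF.lsc hF.quasiconvexOn hx₀ huniq
    (tendsto_of_tendsto_of_tendsto_of_le_of_le tendsto_const_nhds
      (h := fun i => ((τ * a₀ + 1 / 2 * ‖L x₀ - s i‖ ^ 2 +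
        (1 / 2 * ‖L (x i) - s₀‖ ^ 2 - 1 / 2 * ‖L (x i) - s i‖ ^ 2) : ℝ) : EReal))
      ?_ (fun i => hx₀ (x i)) fun i => ?_)
  · have hlim := (((hs.const_sub (L x₀)).norm.pow 2).const_mul (1 / 2)).const_add (τ * a₀)
      |>.add ((((hLx.sub_const s₀).norm.pow 2).const_mul (1 / 2)).sub
        (((hLx.sub hs).norm.pow 2).const_mul (1 / 2)))
    rw [sub_self, add_zero] at hlim
    rw [ha₀]
    exact_mod_cast hlim
  · have hle := mem_proxSet_iff.1 (hx i) x₀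
    rw [ha, ha₀] at hle
    simp only [ha]
    norm_cast at hle ⊢
    linarith

end WellPosedness

section ADMM

variable {X Y U : Type*} [NormedAddCommGroup X] [InnerProductSpace ℝ X] [NormedAddCommGroup Y]
  [InnerProductSpace ℝ Y] [NormedAddCommGroup U] [InnerProductSpace ℝ U] {f : X → EReal}
  {g : Y → EReal} {L : X →L[ℝ] U} {K : Y →L[ℝ] U} {c : U} {τ : ℝ} {ρ : ℕ → ℝ} {xh : ℕ → X}
  {y : ℕ → Y}

theorem proxSet_neg (K : Y →L[ℝ] U) (s : U) : proxSet τ g (-K) s =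
    argminSet fun y => (τ : EReal) * g y + ((1 / 2 * ‖K y + s‖ ^ 2 : ℝ) : EReal) := by
  simp only [proxSet, neg_apply, ← neg_add', norm_neg]

theorem IsADMM.isDouglasRachford {v vh : ℕ → U} (h : IsADMM f g L K c τ ρ xh y v vh) :
    IsDouglasRachford f g L K c τ ρ xh y fun i => -K (y i) + c - v i := by
  refine ⟨fun i => ?_, fun i => ?_, fun i => ?_⟩
  · have hx : ∀ x, L x - (-K (y i) + c - v i) = L x + K (y i) - c + v i := fun x => by abel
    simpa only [hx] using h.x_step i
  · have hy : ∀ y', K y' - c + (2 : ℝ) • L (xh i) - (-K (y i) + c - v i) =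
        L (xh i) + K y' - c + vh i := fun y' => by
      rw [h.v_half_step]
      module
    simpa only [hy] using h.y_step i
  · simp only [h.v_step, h.v_half_step]
    module

namespace IsDouglasRachford

variable {s : ℕ → U}

theorem isADMM (h : IsDouglasRachford f g L K c τ ρ xh y s) :
    IsADMM f g L K c τ ρ xh y (fun i => -K (y i) + c - s i) (fun i => L (xh i) - s i) := by
  refine ⟨fun i => ?_, fun i => ?_, fun i => ?_, fun i => ?_⟩
  · have hx : ∀ x, L x + K (y i) - c + (-K (y i) + c - s i) = L x - s i := fun x => by abel
    simpa only [hx] using h.x_step i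
  · abel
  · have hy : ∀ y', L (xh i) + K y' - c + (L (xh i) - s i) =
        K y' - c + (2 : ℝ) • L (xh i) - s i := fun y' => by module
    simpa only [hy] using h.y_step i
  · simp only [h.s_step]
    module

theorem mem_proxSet_neg (h : IsDouglasRachford f g L K c τ ρ xh y s) (i : ℕ) :
    y (i + 1) ∈ proxSet τ g (-K) ((2 : ℝ) • L (xh i) - s i - c) := by
  have hy : ∀ y', K y' + ((2 : ℝ) • L (xh i) - s i - c) = K y' - c + (2 : ℝ) • L (xh i) - s i :=
    fun y' => by abel
  simpa only [proxSet_neg, hy] using h.y_step i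

theorem exists_weaklyTendsto [CompleteSpace U] (h : IsDouglasRachford f g L K c τ ρ xh y s)
    (hLf : IsExactPostcomp L f) (hKg : IsExactPostcomp (-K) g)
    (hφ : IsGammaZero (infPostcomp L f)) (hψ : IsGammaZero (infPostcomp (-K) g)) (hτ : 0 < τ)
    (hρ : ∀ i, ρ i ∈ Set.Icc (0 : ℝ) 2)
    (hρ_sum : Tendsto (fun n => ∑ i ∈ Finset.range n, ρ i * (2 - ρ i)) atTop atTop)
    {r w : U} (h₀ : IsFenchelPair (infPostcomp L f) (fun r => infPostcomp (-K) g (r - c)) r w) :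
    ∃ r w, IsFenchelPair (infPostcomp L f) (fun r => infPostcomp (-K) g (r - c)) r w ∧
      WeaklyTendsto s (r + τ • w) ∧ WeaklyTendsto (fun i => L (xh i)) r ∧
      WeaklyTendsto (fun i => -K (y i) + c) r ∧
      Tendsto (fun i => L (xh i) + K (y (i + 1)) - c) atTop (𝓝 0) := by
  have hresidual : ∀ i, L (xh i) + K (y (i + 1)) - c = L (xh i) - (-K (y (i + 1)) + c) :=
    fun i => by abel
  have hq : ∀ i, -K (y (i + 1)) + c ∈
      proxSet τ (fun r => infPostcomp (-K) g (r - c)) id ((2 : ℝ) • L (xh i) - s i) := fun i => by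
    rw [mem_proxSet_comp_sub_const, add_sub_cancel_right]
    exact ((hKg.mem_proxSet_iff hτ).1 (h.mem_proxSet_neg i)).1
  obtain ⟨r, w, hrw, hs, hp, hpq⟩ := IsFenchelPair.exists_weaklyTendsto_of_mem_proxSet hφ
    (hψ.comp_sub_const c) hτ hρ hρ_sum (fun i => ((hLf.mem_proxSet_iff hτ).1 (h.x_step i)).1) hq
    (fun i => by rw [h.s_step, hresidual]) h₀
  have hq_lim : TendstoWeakly (fun i => -K (y (i + 1)) + c) atTop r := by
    simpa only [sub_sub_cancel, sub_zero] using TendstoWeakly.sub hp (.of_tendsto hpq)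
  exact ⟨r, w, hrw, hs, hp,
    (tendsto_add_atTop_iff_nat (f := fun i => toWeakSpace ℝ U (-K (y i) + c)) 1).1 hq_lim,
    by simpa only [hresidual] using hpq⟩

end IsDouglasRachford

theorem IsADMM.exists_weaklyTendsto [CompleteSpace U] {v vh : ℕ → U}
    (h : IsADMM f g L K c τ ρ xh y v vh)
    (hLf : IsExactPostcomp L f) (hKg : IsExactPostcomp (-K) g)
    (hφ : IsGammaZero (infPostcomp L f)) (hψ : IsGammaZero (infPostcomp (-K) g)) (hτ : 0 < τ)
    (hρ : ∀ i, ρ i ∈ Set.Icc (0 : ℝ) 2)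
    (hρ_sum : Tendsto (fun n => ∑ i ∈ Finset.range n, ρ i * (2 - ρ i)) atTop atTop)
    {r w : U} (h₀ : IsFenchelPair (infPostcomp L f) (fun r => infPostcomp (-K) g (r - c)) r w) :
    ∃ r w, IsFenchelPair (infPostcomp L f) (fun r => infPostcomp (-K) g (r - c)) r w ∧
      WeaklyTendsto (fun i => L (xh i)) r ∧ WeaklyTendsto (fun i => -K (y i) + c) r ∧
      WeaklyTendsto (fun i => τ⁻¹ • vh i) (-w) ∧ WeaklyTendsto (fun i => τ⁻¹ • v i) (-w) ∧
      Tendsto (fun i => L (xh i) + K (y (i + 1)) - c) atTop (𝓝 0) := by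
  obtain ⟨r, w, hrw, hs, hx, hy, hres⟩ :=
    h.isDouglasRachford.exists_weaklyTendsto hLf hKg hφ hψ hτ hρ hρ_sum h₀
  have hscale : ∀ {z : ℕ → U}, WeaklyTendsto z r →
      WeaklyTendsto (fun i => τ⁻¹ • (z i - (-K (y i) + c - v i))) (-w) := fun hz => by
    have := (TendstoWeakly.sub hz hs).const_smul τ⁻¹
    rwa [sub_add_cancel_left, ← smul_neg, inv_smul_smul₀ hτ.ne'] at this
  refine ⟨r, w, hrw, hx, hy, ?_, by simpa only [sub_sub_cancel] using hscale hy, hres⟩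
  convert hscale hx using 3 with i
  rw [h.v_half_step]
  abel

theorem isPrimalSol_of_isPostcompSol {x : X} {y : Y} {r : U}
    (hr : IsPostcompSol f g L K c r) (hx : L x = r) (hy : -K y + c = r)
    (hfx : f x = infPostcomp L f (L x)) (hgy : g y = infPostcomp (-K) g ((-K) y)) :
    IsPrimalSol f g L K c x y := by
  have hfeas : ∀ {x y r}, L x = r → (L x + K y = c ↔ (-K) y = r - c) := by
    rintro x y - rfl
    rw [neg_apply, neg_eq_iff_add_eq_zero, ← sub_eq_zero, ← add_sub_assoc, add_comm]
  have hyr : (-K) y = r - c := eq_sub_of_add_eq hy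
  refine ⟨(hfeas hx).2 hyr, fun x' y' hxy' => ?_⟩
  rw [hfx, hgy, hx, hyr]
  refine (hr (L x')).trans (add_le_add (infPostcomp_apply_le L f x') ?_)
  rw [← (hfeas rfl).1 hxy']
  exact infPostcomp_apply_le (-K) g y'

theorem IsDouglasRachford.exists_tendsto [FiniteDimensional ℝ X] [FiniteDimensional ℝ Y]
    [FiniteDimensional ℝ U] {s : ℕ → U} (h : IsDouglasRachford f g L K c τ ρ xh y s)
    (hf : IsGammaZero f) (hg : IsGammaZero g)
    (hLf : IsExactPostcomp L f) (hKg : IsExactPostcomp (-K) g)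
    (hφ : IsGammaZero (infPostcomp L f)) (hψ : IsGammaZero (infPostcomp (-K) g)) (hτ : 0 < τ)
    (hρ : ∀ i, ρ i ∈ Set.Icc (0 : ℝ) 2)
    (hρ_sum : Tendsto (fun n => ∑ i ∈ Finset.range n, ρ i * (2 - ρ i)) atTop atTop)
    {r w : U} (h₀ : IsFenchelPair (infPostcomp L f) (fun r => infPostcomp (-K) g (r - c)) r w)
    (hf_uniq : ∀ s, (proxSet τ f L s).Subsingleton)
    (hg_uniq : ∀ s, (proxSet τ g (-K) s).Subsingleton) :
    ∃ x' y', IsPrimalSol f g L K c x' y' ∧ Tendsto (fun i => (xh i, y i)) atTop (𝓝 (x', y')) := by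
  obtain ⟨r, w, hrw, hs, hx, hy, -⟩ := h.exists_weaklyTendsto hLf hKg hφ hψ hτ hρ hρ_sum h₀
  replace hs := TendstoWeakly.tendsto hs
  replace hx := TendstoWeakly.tendsto hx
  replace hy := TendstoWeakly.tendsto hy
  obtain ⟨x', hx'⟩ := hLf.nonempty_proxSet hφ hτ (r + τ • w)
  obtain ⟨y', hy'⟩ := hKg.nonempty_proxSet hψ hτ ((2 : ℝ) • r - (r + τ • w) - c)
  have hxlim : Tendsto xh atTop (𝓝 x') :=
    hf.tendsto_of_mem_proxSet hτ h.x_step hx' (hf_uniq _) hs hx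
  have hKy : Tendsto (fun i => (-K) (y (i + 1))) atTop (𝓝 (r - c)) := by
    simpa only [neg_apply, add_sub_cancel_right] using
      ((tendsto_add_atTop_iff_nat 1).2 hy).sub_const c
  have hylim : Tendsto y atTop (𝓝 y') := (tendsto_add_atTop_iff_nat 1).1 <|
    hg.tendsto_of_mem_proxSet hτ h.mem_proxSet_neg hy' (hg_uniq _)
      (((hx.const_smul (2 : ℝ)).sub hs).sub_const c) hKy
  have hLx : L x' = r := tendsto_nhds_unique ((L.continuous.tendsto _).comp hxlim) hx
  have hKy' : -K y' + c = r :=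
    tendsto_nhds_unique (((K.continuous.tendsto _).comp hylim).neg.add_const c) hy
  exact ⟨x', y', isPrimalSol_of_isPostcompSol (hrw.mem_argminSet_add hφ (hψ.comp_sub_const c)) hLx
    hKy' ((hLf.mem_proxSet_iff hτ).1 hx').2 ((hKg.mem_proxSet_iff hτ).1 hy').2,
    hxlim.prodMk_nhds hylim⟩

variable [CompleteSpace X] [CompleteSpace Y] [CompleteSpace U]

theorem IsPrimalDualSol.isFenchelPair {x : X} {y : Y} {u : U}
    (h : IsPrimalDualSol f g L K c x y u) :
    IsFenchelPair (infPostcomp L f) (fun r => infPostcomp (-K) g (r - c)) (L x) (-u) := by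
  obtain ⟨⟨a, ha, ha'⟩, ⟨b, hb, hb'⟩, hc⟩ := h
  have hKy : L x - c = (-K) y := by
    rw [neg_apply, ← sub_eq_zero, ← neg_eq_zero, hc]
    abel
  refine ⟨mem_subdiff_infPostcomp ?_, ?_⟩
  · rwa [map_neg, ← eq_neg_of_add_eq_zero_left ha'.symm]
  · rw [mem_subdiff_comp_sub_const, neg_neg, hKy]
    refine mem_subdiff_infPostcomp ?_
    rwa [map_neg, neg_apply, ← eq_neg_of_add_eq_zero_left hb'.symm]

theorem isDualSol_iff_mem_argminSet {u : U} :
    IsDualSol f g L K c u ↔ u ∈ argminSet fun u => fenchelConj (infPostcomp L f) (-u) +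
      fenchelConj (fun r => infPostcomp (-K) g (r - c)) u := by
  simp only [IsDualSol, fenchelConj_comp_sub_const (φ := infPostcomp (-K) g),
    fenchelConj_infPostcomp, map_neg, neg_apply, add_assoc]

end ADMM

theorem theorem4p7
    {X Y U : Type*}
    [NormedAddCommGroup X] [InnerProductSpace ℝ X] [CompleteSpace X]
    [NormedAddCommGroup Y] [InnerProductSpace ℝ Y] [CompleteSpace Y]
    [NormedAddCommGroup U] [InnerProductSpace ℝ U] [CompleteSpace U]
    (f : X → EReal) (hf : IsGammaZero f) (g : Y → EReal) (hg : IsGammaZero g)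
    (L : X →L[ℝ] U) (hL : L ≠ 0) (K : Y →L[ℝ] U) (hK : K ≠ 0) (c : U)
    -- the primal-dual inclusion has a solution
    (hsol : ∃ (x : X) (y : Y) (u : U), IsPrimalDualSol f g L K c x y u)
    -- the infimal postcompositions are exact and lower semicontinuous
    (hLf : IsExactPostcomp L f) (hKg : IsExactPostcomp (-K) g)
    (hLf_lsc : LowerSemicontinuous (infPostcomp L f))
    (hKg_lsc : LowerSemicontinuous (infPostcomp (-K) g))
    -- parameters and initialization
    (τ : ℝ) (hτ : 0 < τ) (ρ : ℕ → ℝ) (hρ : ∀ i, ρ i ∈ Set.Icc (0 : ℝ) 2)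
    (hρ_sum : Tendsto (fun n => ∑ i ∈ Finset.range n, ρ i * (2 - ρ i)) atTop atTop)
    (y₀ : Y) (v₀ s₀ : U) (hs₀ : s₀ = -K y₀ + c - v₀) :
    -- all subproblems have minimizers, so that the iterations can be carried out
    ((∀ r : U, (argminSet fun x : X =>
        (τ : EReal) * f x + ((1 / 2 * ‖L x - r‖ ^ 2 : ℝ) : EReal)).Nonempty) ∧
      (∀ r : U, (argminSet fun y : Y =>
        (τ : EReal) * g y + ((1 / 2 * ‖K y + r‖ ^ 2 : ℝ) : EReal)).Nonempty)) ∧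
    -- the two iterations generate the same sequences `x^(i+1/2)`, `y^(i)`
    (∀ (xh : ℕ → X) (y : ℕ → Y), y 0 = y₀ →
      ((∃ v vh : ℕ → U, v 0 = v₀ ∧ IsADMM f g L K c τ ρ xh y v vh) ↔
        (∃ s : ℕ → U, s 0 = s₀ ∧ IsDouglasRachford f g L K c τ ρ xh y s))) ∧
    -- convergence of the ADMM
    (∀ (xh : ℕ → X) (y : ℕ → Y) (v vh : ℕ → U), y 0 = y₀ → v 0 = v₀ →
      IsADMM f g L K c τ ρ xh y v vh →
      (∃ r : U, IsPostcompSol f g L K c r ∧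
        WeaklyTendsto (fun i => L (xh i)) r ∧
        WeaklyTendsto (fun i => -K (y i) + c) r) ∧
      (∃ u : U, IsDualSol f g L K c u ∧
        WeaklyTendsto (fun i => τ⁻¹ • vh i) u ∧
        WeaklyTendsto (fun i => τ⁻¹ • v i) u) ∧
      Tendsto (fun i => L (xh i) + K (y (i + 1)) - c) atTop (𝓝 0)) ∧
    -- convergence of the Douglas-Rachford algorithm
    (∀ (xh : ℕ → X) (y : ℕ → Y) (s : ℕ → U), y 0 = y₀ → s 0 = s₀ →
      IsDouglasRachford f g L K c τ ρ xh y s →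
      (∃ r : U, IsPostcompSol f g L K c r ∧
        WeaklyTendsto (fun i => L (xh i)) r ∧
        WeaklyTendsto (fun i => -K (y i) + c) r) ∧
      Tendsto (fun i => L (xh i) + K (y (i + 1)) - c) atTop (𝓝 0)) ∧
    -- finite dimension and unique minimizers: convergence to a primal solution
    (FiniteDimensional ℝ X → FiniteDimensional ℝ Y → FiniteDimensional ℝ U →
      (∀ r : U, (argminSet fun x : X =>
        (τ : EReal) * f x + ((1 / 2 * ‖L x - r‖ ^ 2 : ℝ) : EReal)).Subsingleton) →
      (∀ r : U, (argminSet fun y : Y =>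
        (τ : EReal) * g y + ((1 / 2 * ‖K y + r‖ ^ 2 : ℝ) : EReal)).Subsingleton) →
      (∀ (xh : ℕ → X) (y : ℕ → Y) (v vh : ℕ → U), y 0 = y₀ → v 0 = v₀ →
        IsADMM f g L K c τ ρ xh y v vh →
        ∃ (x' : X) (y' : Y), IsPrimalSol f g L K c x' y' ∧
          Tendsto (fun i => (xh i, y i)) atTop (𝓝 (x', y'))) ∧
      (∀ (xh : ℕ → X) (y : ℕ → Y) (s : ℕ → U), y 0 = y₀ → s 0 = s₀ →
        IsDouglasRachford f g L K c τ ρ xh y s →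
        ∃ (x' : X) (y' : Y), IsPrimalSol f g L K c x' y' ∧
          Tendsto (fun i => (xh i, y i)) atTop (𝓝 (x', y')))) := by
  have hφ := hLf.isGammaZero hf hLf_lsc
  have hψ := hKg.isGammaZero hg hKg_lsc
  have hψc := hψ.comp_sub_const c
  obtain ⟨x₁, y₁, u₁, h₁⟩ := hsol
  have h₀ := h₁.isFenchelPair
  refine ⟨⟨hLf.nonempty_proxSet hφ hτ, fun r => proxSet_neg K r ▸ hKg.nonempty_proxSet hψ hτ r⟩,
    fun xh y hy₀ => ⟨?_, ?_⟩, fun xh y v vh _ _ h => ?_, fun xh y s _ _ h => ?_,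
    fun _ _ _ hf_uniq hg_uniq => ?_⟩
  · rintro ⟨v, vh, hv₀, h⟩
    exact ⟨_, by rw [hy₀, hv₀, hs₀], h.isDouglasRachford⟩
  · rintro ⟨s, hs, h⟩
    exact ⟨_, _, by rw [hy₀, hs, hs₀, sub_sub_cancel], h.isADMM⟩
  · obtain ⟨r, w, hrw, hx, hy, hvh, hv, hres⟩ :=
      h.exists_weaklyTendsto hLf hKg hφ hψ hτ hρ hρ_sum h₀
    exact ⟨⟨r, hrw.mem_argminSet_add hφ hψc, hx, hy⟩, ⟨-w, isDualSol_iff_mem_argminSet.2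
      (hrw.neg_mem_argminSet_fenchelConj hφ hψc), hvh, hv⟩, hres⟩
  · obtain ⟨r, w, hrw, -, hx, hy, hres⟩ := h.exists_weaklyTendsto hLf hKg hφ hψ hτ hρ hρ_sum h₀
    exact ⟨⟨r, hrw.mem_argminSet_add hφ hψc, hx, hy⟩, hres⟩
  · have hlim : ∀ {xh y s}, IsDouglasRachford f g L K c τ ρ xh y s → _ := fun h =>
      h.exists_tendsto hf hg hLf hKg hφ hψ hτ hρ hρ_sum h₀ hf_uniq
        fun r => proxSet_neg K r ▸ hg_uniq r
    exact ⟨fun xh y v vh _ _ h => hlim h.isDouglasRachford, fun xh y s _ _ h => hlim h⟩
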